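/- Let $(M,\widetilde{\mathcal O})$ be a complex supermanifold of dimension $n|m$: a topological space with a sheaf of supercommutative $\mathbb C$-superalgebras that is locally isomorphic to open subsets of $(\mathbb C^n,\Lambda_{\mathcal O}[\xi_1,\dots,\xi_m])$, where $\mathcal O$ is the sheaf of holomorphic functions and the $\xi_j$ are odd. Let $\mathcal I\subset\widetilde{\mathcal O}$ be the sheaf of ideals generated by the odd elements, and let the odd tangent bundle $T_{\bar 1}$ be the holomorphic vector bundle on $(M,\widetilde{\mathcal O}/\mathcal I)$ whose sheaf of sections is $(\mathcal I/\mathcal I^2)^*$. Let $\mathfrak d=\Gamma(M,\mathcal{D}er\,\widetilde{\mathcal O})$ be the Lie superalgebra of global superderivations (vector fields), filtered by $\mathfrak d_{(-1)}=\mathfrak d$ and $$\mathfrak d_{(p)}=\{\delta\in\mathfrak d \mid \delta\widetilde{\mathcal O}\subset\mathcal I^p,\ \delta\mathcal I\subset\mathcal I^{p+1}\}\qquad (p\ge 0).$$ Put $\mathfrak d_0=\mathfrak d_{(0)}/\mathfrak d_{(1)}$ and $\mathfrak d_{-1}=\mathfrak d/\mathfrak d_{(0)}$; the latter is regarded as a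 subspace of $\Gamma(M,T_{\bar 1})$, the class of $\gamma$ being the section $s\mapsto \gamma(s) \bmod \mathcal I$ for $s\in\mathcal I$. 1. Suppose that (a) every point of every fibre of $T_{\bar 1}$ lies in the image of a section belonging to $\mathfrak d_{-1}$, and (b) the adjoint action of $\mathfrak d_0$ on $\mathfrak d_{-1}$ is faithful. Then the filtered Lie superalgebra $\mathfrak d$ is transitive, that is, $\mathfrak d_{(p+1)}=\{x\in\mathfrak d_{(p)}\mid [x,\mathfrak d]\subset\mathfrak d_{(p)}\}$ for all $p\ge 0$. 2. Let $(M,\widetilde{\mathcal O})$ be split, that is, $\widetilde{\mathcal O}=\Lambda_{\mathcal O}(\mathcal F)$ with a locally free sheaf $\mathcal F$ of rank $m$ on an $n$-dimensional complex manifold $(M,\mathcal O)$, graded by $\widetilde{\mathcal O}_q=\Lambda^q_{\mathcal O}(\mathcal F)$, and let now $\mathfrak d_p=\{\delta\in\mathfrak d\mid \delta\widetilde{\mathcal O}_q\subset\widetilde{\mathcal O}_{q+p}\text{ for all }q\}$, so that $\mathfrak d=\bigoplus_{p\ge -1}\mathfrak d_p$. Suppose that a global holomorphic section of $T_{\bar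 1}$ passes through every point of every fibre of $T_{\bar 1}$. Then for all $p>0$ $$\{x\in\mathfrak d_p\mid [x,\mathfrak d_q]=0\text{ for all }q<0\}=0 .$$ If, moreover, the adjoint representation of $\mathfrak d_0$ in $\mathfrak d_{-1}$ is faithful, then this equality holds for all $p\ge 0$, that is, the graded Lie superalgebra $\mathfrak d$ is transitive. -/

import Mathlib

set_option maxSynthPendingDepth 3

open CategoryTheory TopologicalSpace Opposite
open scoped TensorProduct

universe u

/-! ### Superspaces: sheaves of supercommutative complex superalgebras -/

/-- A topological space `M` with a sheaf of supercommutative superalgebras over `ℂ`: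
`parity U 0` and `parity U 1` are the even and the odd sections over `U`. -/
structure SuperSpace (M : Type u) [TopologicalSpace M] where
  presheaf : TopCat.Presheaf (AlgCat.{u} ℂ) (TopCat.of M)
  isSheaf : presheaf.IsSheaf
  parity : ∀ U : Opens M, ZMod 2 → Submodule ℂ (presheaf.obj (op U))
  graded : ∀ U : Opens M, GradedAlgebra (parity U)
  map_parity : ∀ {U V : Opens M} (h : V ≤ U) (i : ZMod 2) (s : presheaf.obj (op U)),
    s ∈ parity U i → (presheaf.map (homOfLE h).op).hom s ∈ parity V i
  supercomm : ∀ (U : Opens M) (i j : ZMod 2) (a b : presheaf.obj (op U)),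
    a ∈ parity U i → b ∈ parity U j → a * b = (-1 : ℂ) ^ (i.val * j.val) • (b * a)

namespace SuperSpace

variable {M : Type u} [TopologicalSpace M] (X : SuperSpace M)

/-- The algebra of sections of the structure sheaf over `U`. -/
abbrev sec (U : Opens M) : Type u := X.presheaf.obj (op U)

instance (U : Opens M) : GradedAlgebra (X.parity U) := X.graded U

/-- Restriction of sections. -/
def res {U V : Opens M} (h : V ≤ U) : X.sec U →ₐ[ℂ] X.sec V :=
  (X.presheaf.map (homOfLE h).op).hom

theorem res_res {U V W : Opens M} (h : V ≤ U) (h' : W ≤ V) (s : X.sec U) :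
    X.res h' (X.res h s) = X.res (h'.trans h) s := by
  have : X.presheaf.map (homOfLE (h'.trans h)).op =
      X.presheaf.map (homOfLE h).op ≫ X.presheaf.map (homOfLE h').op := by
    rw [← Functor.map_comp]; rfl
  simp only [res, this]
  rfl

/-- The homogeneous component of parity `i` of a section. -/
def proj (U : Opens M) (i : ZMod 2) : X.sec U →ₗ[ℂ] X.sec U :=
  GradedAlgebra.proj (X.parity U) i

/-! ### Powers of the ideal sheaf generated by the odd sections -/

/-- The ideal of the ring of sections over `U` generated by the odd sections over `U`. -/
def oddSpan (U : Opens M) : Ideal (X.sec U) := Ideal.span (X.parity U 1 : Set (X.sec U))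

theorem Ideal_pow_map {A B : Type u} [Ring A] [Ring B] (f : A →+* B) (I : Ideal A) (J : Ideal B)
    (h : ∀ a ∈ I, f a ∈ J) (p : ℕ) : ∀ a ∈ I ^ p, f a ∈ J ^ p := by
  induction p with
  | zero => intro a _; rw [Submodule.pow_zero, Ideal.one_eq_top]; trivial
  | succ k ih =>
    intro a ha
    rw [Submodule.pow_succ] at ha ⊢
    induction ha using Submodule.mul_induction_on' with
    | mem_mul_mem m hm n hn =>
      rw [map_mul]
      exact Submodule.mul_mem_mul (ih m hm) (h n hn)
    | add x _ y _ hx hy => rw [map_add]; exact add_mem hx hy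

theorem res_oddSpan {U V : Opens M} (h : V ≤ U) :
    ∀ a ∈ X.oddSpan U, X.res h a ∈ X.oddSpan V := by
  intro a ha
  induction ha using Submodule.span_induction with
  | mem x hx => exact Ideal.subset_span (X.map_parity h 1 x hx)
  | zero => simp
  | add x y _ _ hx hy => rw [map_add]; exact add_mem hx hy
  | smul c x _ hx => rw [smul_eq_mul, map_mul]; exact Ideal.mul_mem_left _ _ hx

theorem res_oddSpan_pow {U V : Opens M} (h : V ≤ U) (p : ℕ) :
    ∀ a ∈ X.oddSpan U ^ p, X.res h a ∈ X.oddSpan V ^ p :=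
  Ideal_pow_map (X.res h).toRingHom _ _ (X.res_oddSpan h) p

/-- Sections over `U` of the `p`-th power `𝓘 ^ p` of the sheaf of ideals `𝓘` generated by the odd
sections: the sections that locally lie in the `p`-th power of the ideal generated by the
odd sections. -/
def oddPow (p : ℕ) (U : Opens M) : Ideal (X.sec U) where
  carrier := {s | ∀ w ∈ U, ∃ (V : Opens M) (h : V ≤ U), w ∈ V ∧ X.res h s ∈ X.oddSpan V ^ p}
  zero_mem' := fun w hw => ⟨U, le_rfl, hw, by simp⟩
  add_mem' := by
    intro a b ha hb w hw
    obtain ⟨V, h, hwV, hV⟩ := ha w hw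
    obtain ⟨V', h', hwV', hV'⟩ := hb w hw
    refine ⟨V ⊓ V', inf_le_left.trans h, ⟨hwV, hwV'⟩, ?_⟩
    rw [map_add, ← X.res_res h inf_le_left, ← X.res_res h' inf_le_right]
    exact add_mem (X.res_oddSpan_pow _ _ _ hV) (X.res_oddSpan_pow _ _ _ hV')
  smul_mem' := by
    intro c a ha w hw
    obtain ⟨V, h, hwV, hV⟩ := ha w hw
    refine ⟨V, h, hwV, ?_⟩
    rw [smul_eq_mul, map_mul]
    exact Ideal.mul_mem_left _ _ hV

/-- Sections over `U` of the sheaf of ideals `𝓘` generated by the odd sections. -/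
abbrev oddIdeal (U : Opens M) : Ideal (X.sec U) := X.oddPow 1 U

theorem res_oddPow {U V : Opens M} (h : V ≤ U) (p : ℕ) (s : X.sec U) (hs : s ∈ X.oddPow p U) :
    X.res h s ∈ X.oddPow p V := by
  intro w hw
  obtain ⟨W, hW, hwW, hs'⟩ := hs w (h hw)
  refine ⟨W ⊓ V, inf_le_right, ⟨hwW, hw⟩, ?_⟩
  rw [X.res_res, ← X.res_res hW inf_le_left]
  exact X.res_oddSpan_pow _ _ _ hs'

/-! ### Vector fields and their superbracket -/

/-- Families of `ℂ`-linear endomorphisms of the spaces of sections over all open sets. -/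
abbrev PreEnd : Type u := ∀ U : Opens M, Module.End ℂ (X.sec U)

/-- The homogeneous component of parity `a` of a family of linear endomorphisms. -/
def part (a : ZMod 2) : X.PreEnd →ₗ[ℂ] X.PreEnd where
  toFun T := fun U => ∑ b : ZMod 2, X.proj U (a + b) ∘ₗ T U ∘ₗ X.proj U b
  map_add' S T := by
    funext U
    simp [LinearMap.comp_add, LinearMap.add_comp, Finset.sum_add_distrib]
  map_smul' c T := by
    funext U
    simp [LinearMap.comp_smul, LinearMap.smul_comp, Finset.smul_sum]

/-- The superbracket: `[S, T] = S T - (-1) ^ (a b) T S` for `S`, `T` of parities `a`, `b`, extended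
bilinearly. -/
def superBracket : X.PreEnd →ₗ[ℂ] X.PreEnd →ₗ[ℂ] X.PreEnd :=
  LinearMap.mk₂ ℂ
    (fun S T => ∑ a : ZMod 2, ∑ b : ZMod 2,
      (X.part a S * X.part b T - (-1 : ℂ) ^ (a.val * b.val) • (X.part b T * X.part a S)))
    (by intro S S' T
        simp only [map_add, add_mul, mul_add, smul_add, ← Finset.sum_add_distrib]
        refine Finset.sum_congr rfl fun a _ => Finset.sum_congr rfl fun b _ => by abel)
    (by intro c S T
        simp only [map_smul, smul_mul_assoc, mul_smul_comm, Finset.smul_sum, smul_sub]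
        refine Finset.sum_congr rfl fun a _ => Finset.sum_congr rfl fun b _ => by
          rw [smul_comm c])
    (by intro S T T'
        simp only [map_add, add_mul, mul_add, smul_add, ← Finset.sum_add_distrib]
        refine Finset.sum_congr rfl fun a _ => Finset.sum_congr rfl fun b _ => by abel)
    (by intro c S T
        simp only [map_smul, smul_mul_assoc, mul_smul_comm, Finset.smul_sum, smul_sub]
        refine Finset.sum_congr rfl fun a _ => Finset.sum_congr rfl fun b _ => by
          rw [smul_comm c])

/-- The global superderivations of parity `a` of the structure sheaf: the `ℂ`-linear sheaf
endomorphisms `δ` of parity `a` with `δ (f g) = δ(f) g + (-1) ^ (a b) f δ(g)` for `f` of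
parity `b`. -/
def superDer (a : ZMod 2) : Submodule ℂ X.PreEnd where
  carrier := {δ |
    (∀ (U V : Opens M) (h : V ≤ U) (s : X.sec U), X.res h (δ U s) = δ V (X.res h s)) ∧
    (∀ (U : Opens M) (b : ZMod 2) (s : X.sec U), s ∈ X.parity U b → δ U s ∈ X.parity U (a + b)) ∧
    (∀ (U : Opens M) (b : ZMod 2) (f g : X.sec U), f ∈ X.parity U b →
      δ U (f * g) = δ U f * g + (-1 : ℂ) ^ (a.val * b.val) • (f * δ U g))}
  zero_mem' := by
    refine ⟨fun U V h s => by simp, fun U b s _ => by simp, fun U b f g _ => by simp⟩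
  add_mem' := by
    rintro δ ε ⟨h1, h2, h3⟩ ⟨h1', h2', h3'⟩
    refine ⟨fun U V h s => ?_, fun U b s hs => ?_, fun U b f g hf => ?_⟩
    · simp [h1 U V h s, h1' U V h s]
    · exact add_mem (h2 U b s hs) (h2' U b s hs)
    · simp only [Pi.add_apply, LinearMap.add_apply, h3 U b f g hf, h3' U b f g hf, add_mul,
        mul_add, smul_add]
      abel
  smul_mem' := by
    rintro c δ ⟨h1, h2, h3⟩
    refine ⟨fun U V h s => ?_, fun U b s hs => ?_, fun U b f g hf => ?_⟩
    · simp [h1 U V h s]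
    · exact Submodule.smul_mem _ c (h2 U b s hs)
    · simp only [Pi.smul_apply, LinearMap.smul_apply, h3 U b f g hf, smul_add, smul_mul_assoc,
        mul_smul_comm]
      rw [smul_comm c]

/-- The space `𝔡 = Γ(M, Der)` of vector fields: sums of even and odd superderivations of the
structure sheaf. -/
def vectorFields : Submodule ℂ X.PreEnd := ⨆ a : ZMod 2, X.superDer a

section Proofs

theorem proj_of_mem {U : Opens M} {i : ZMod 2} {s : X.sec U} (hs : s ∈ X.parity U i) (j : ZMod 2) :
    X.proj U j s = if i = j then s else 0 := by
  have h : X.proj U j s = ((DirectSum.decompose (X.parity U) s) j : X.sec U) := rfl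
  rw [h]
  split_ifs with hij
  · subst hij; exact DirectSum.decompose_of_mem_same _ hs
  · exact DirectSum.decompose_of_mem_ne _ hs hij

theorem proj_mem (U : Opens M) (i : ZMod 2) (s : X.sec U) : X.proj U i s ∈ X.parity U i :=
  (DirectSum.decompose (X.parity U) s i).2

theorem sum_proj (U : Opens M) (s : X.sec U) : ∑ i : ZMod 2, X.proj U i s = s := by
  have h : ∀ i, X.proj U i s = ((DirectSum.decompose (X.parity U) s) i : X.sec U) := fun _ => rfl
  simp only [h]
  classical
  conv_rhs => rw [← DirectSum.sum_support_decompose (X.parity U) s]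
  refine (Finset.sum_subset (Finset.subset_univ _) fun i _ hi => ?_).symm
  simpa using hi

theorem proj_mul (U : Opens M) (i : ZMod 2) (s t : X.sec U) :
    X.proj U i (s * t) = ∑ j : ZMod 2, X.proj U j s * X.proj U (i - j) t := by
  conv_lhs => rw [← X.sum_proj U s, ← X.sum_proj U t, Finset.sum_mul_sum, map_sum]
  refine Finset.sum_congr rfl fun j _ => ?_
  rw [map_sum, Finset.sum_eq_single (i - j)]
  · rw [X.proj_of_mem (SetLike.mul_mem_graded (X.proj_mem U j s) (X.proj_mem U _ t)),
      if_pos (by abel)]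
  · intro k _ hk
    rw [X.proj_of_mem (SetLike.mul_mem_graded (X.proj_mem U j s) (X.proj_mem U _ t)), if_neg]
    intro h; exact hk (by rw [← h]; abel)
  · simp

theorem res_proj {U V : Opens M} (h : V ≤ U) (i : ZMod 2) (s : X.sec U) :
    X.res h (X.proj U i s) = X.proj V i (X.res h s) := by
  conv_rhs => rw [← X.sum_proj U s, map_sum, map_sum]
  rw [Finset.sum_eq_single i]
  · exact ((X.proj_of_mem (X.map_parity h i _ (X.proj_mem U i s)) i).trans (if_pos rfl)).symm
  · intro j _ hj
    exact (X.proj_of_mem (X.map_parity h j _ (X.proj_mem U j s)) i).trans (if_neg hj)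
  · simp

theorem proj_oddSpan (U : Opens M) (i : ZMod 2) :
    ∀ s ∈ X.oddSpan U, X.proj U i s ∈ X.oddSpan U := by
  intro s hs
  exact Ideal.homogeneous_span (X.parity U) (X.parity U 1 : Set (X.sec U))
    (fun x hx => ⟨1, hx⟩) i hs

theorem proj_oddSpan_pow (U : Opens M) (k : ℕ) :
    ∀ (i : ZMod 2), ∀ s ∈ X.oddSpan U ^ k, X.proj U i s ∈ X.oddSpan U ^ k := by
  induction k with
  | zero => intro i a _; rw [Submodule.pow_zero, Ideal.one_eq_top]; trivial
  | succ k ih =>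
    intro i a ha
    rw [Submodule.pow_succ] at ha ⊢
    induction ha using Submodule.mul_induction_on' with
    | mem_mul_mem m hm n hn =>
      rw [X.proj_mul]
      exact Submodule.sum_mem _ fun j _ =>
        Submodule.mul_mem_mul (ih _ _ hm) (X.proj_oddSpan _ _ _ hn)
    | add x _ y _ hx hy => rw [map_add]; exact add_mem hx hy

theorem proj_oddPow (U : Opens M) (k : ℕ) (i : ZMod 2) (s : X.sec U) (hs : s ∈ X.oddPow k U) :
    X.proj U i s ∈ X.oddPow k U := by
  intro w hw
  obtain ⟨V, h, hwV, hV⟩ := hs w hw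
  refine ⟨V, h, hwV, ?_⟩
  rw [X.res_proj]
  exact X.proj_oddSpan_pow V k i _ hV

/-- Homogeneous components of a family of endomorphisms respect inclusions between powers of the
odd ideal. -/
theorem part_oddPow (T : X.PreEnd) (U : Opens M) (k l : ℕ)
    (hT : ∀ s ∈ X.oddPow k U, T U s ∈ X.oddPow l U) (a : ZMod 2) :
    ∀ s ∈ X.oddPow k U, X.part a T U s ∈ X.oddPow l U := by
  intro s hs
  have : X.part a T U s = ∑ b : ZMod 2, X.proj U (a + b) (T U (X.proj U b s)) := by
    simp [part]
  rw [this]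
  exact Submodule.sum_mem _ fun b _ => X.proj_oddPow U l _ _ (hT _ (X.proj_oddPow U k b s hs))

theorem part_of_superDer {b : ZMod 2} {δ : X.PreEnd} (hδ : δ ∈ X.superDer b) (a : ZMod 2) :
    X.part a δ = if b = a then δ else 0 := by
  funext U
  ext s
  have h1 : X.part a δ U s = ∑ c : ZMod 2, X.proj U (a + c) (δ U (X.proj U c s)) := by
    simp [part]
  have h2 : ∀ c, X.proj U (a + c) (δ U (X.proj U c s)) = if b = a then δ U (X.proj U c s) else 0 := by
    intro c
    rw [X.proj_of_mem (hδ.2.1 U c _ (X.proj_mem U c s))]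
    simp
  rw [h1]
  simp only [h2]
  split_ifs with h
  · rw [← map_sum, X.sum_proj]
  · simp

theorem superBracket_apply (S T : X.PreEnd) :
    X.superBracket S T = ∑ a : ZMod 2, ∑ b : ZMod 2,
      (X.part a S * X.part b T - (-1 : ℂ) ^ (a.val * b.val) • (X.part b T * X.part a S)) := rfl

theorem superBracket_of_superDer {a b : ZMod 2} {δ ε : X.PreEnd} (hδ : δ ∈ X.superDer a)
    (hε : ε ∈ X.superDer b) :
    X.superBracket δ ε = δ * ε - (-1 : ℂ) ^ (a.val * b.val) • (ε * δ) := by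
  rw [superBracket_apply, Finset.sum_eq_single a, Finset.sum_eq_single b]
  · rw [X.part_of_superDer hδ, X.part_of_superDer hε, if_pos rfl, if_pos rfl]
  · intro c _ hc
    rw [X.part_of_superDer hε c, if_neg (Ne.symm hc)]; simp
  · simp
  · intro c _ hc
    refine Finset.sum_eq_zero fun d _ => ?_
    rw [X.part_of_superDer hδ c, if_neg (Ne.symm hc)]; simp
  · simp

theorem part_mem_superDer {x : X.PreEnd} (hx : x ∈ X.vectorFields) (a : ZMod 2) :
    X.part a x ∈ X.superDer a := by
  induction hx using Submodule.iSup_induction' with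
  | mem b x hx =>
    rw [X.part_of_superDer hx]
    split_ifs with h
    · exact h ▸ hx
    · exact zero_mem _
  | zero => rw [map_zero]; exact zero_mem _
  | add x y _ _ hx hy => rw [map_add]; exact add_mem hx hy

theorem superBracket_superDer {a b : ZMod 2} {δ ε : X.PreEnd} (hδ : δ ∈ X.superDer a)
    (hε : ε ∈ X.superDer b) :
    δ * ε - (-1 : ℂ) ^ (a.val * b.val) • (ε * δ) ∈ X.superDer (a + b) := by
  refine ⟨fun U V h s => ?_, fun U c s hs => ?_, fun U c f g hf => ?_⟩
  · simp [hδ.1 U V h, hε.1 U V h]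
  · refine sub_mem ?_ (Submodule.smul_mem _ _ ?_)
    · have := hδ.2.1 U _ _ (hε.2.1 U c s hs)
      rwa [← add_assoc] at this
    · have := hε.2.1 U _ _ (hδ.2.1 U c s hs)
      rwa [← add_assoc, add_comm b a] at this
  · have e1 := hδ.2.2 U c f g hf
    have e2 := hε.2.2 U c f g hf
    have e3 := hδ.2.2 U _ (ε U f) g (hε.2.1 U c f hf)
    have e4 := hε.2.2 U _ (δ U f) g (hδ.2.1 U c f hf)
    have e5 := hδ.2.2 U c f (ε U g) hf
    have e6 := hε.2.2 U c f (δ U g) hf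
    simp only [Pi.sub_apply, Pi.smul_apply, Pi.mul_apply, LinearMap.sub_apply,
      LinearMap.smul_apply, Module.End.mul_apply, e1, e2, e3, e4, e5, e6, map_add, map_smul]
    have two : ∀ z : ZMod 2, z = 0 ∨ z = 1 := by decide
    have v1 : ((1 : ZMod 2)).val = 1 := rfl
    have v2 : ((1 : ZMod 2) + 1).val = 0 := rfl
    rcases two a with rfl | rfl <;> rcases two b with rfl | rfl <;>
      rcases two c with rfl | rfl <;>
      simp [v1, v2, sub_mul, mul_sub, add_mul, mul_add] <;> abel

theorem superBracket_mem {x y : X.PreEnd} (hx : x ∈ X.vectorFields) (hy : y ∈ X.vectorFields) :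
    X.superBracket x y ∈ X.vectorFields := by
  rw [superBracket_apply]
  exact Submodule.sum_mem _ fun a _ => Submodule.sum_mem _ fun b _ =>
    Submodule.mem_iSup_of_mem (a + b)
      (X.superBracket_superDer (X.part_mem_superDer hx a) (X.part_mem_superDer hy b))

/-- A homogeneous superderivation maps the square of the odd ideal into the odd ideal. -/
theorem superDer_oddPow_two {a : ZMod 2} {δ : X.PreEnd} (hδ : δ ∈ X.superDer a) (U : Opens M) :
    ∀ s ∈ X.oddPow 2 U, δ U s ∈ X.oddPow 1 U := by
  have right : ∀ (V : Opens M) (m : X.sec V), m ∈ X.oddSpan V → ∀ t : X.sec V,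
      m * t ∈ X.oddSpan V := by
    intro V m hm t
    induction hm using Submodule.span_induction with
    | mem x hx =>
      rw [← X.sum_proj V t, Finset.mul_sum]
      refine Submodule.sum_mem _ fun i _ => ?_
      rw [X.supercomm V 1 i x _ hx (X.proj_mem V i t), ← smul_mul_assoc]
      exact Ideal.mul_mem_left _ _ (Ideal.subset_span hx)
    | zero => simp
    | add x y _ _ hx hy => rw [add_mul]; exact add_mem hx hy
    | smul c x _ hx => rw [smul_eq_mul, mul_assoc]; exact Ideal.mul_mem_left _ _ hx
  intro s hs w hw
  obtain ⟨V, h, hwV, hV⟩ := hs w hw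
  refine ⟨V, h, hwV, ?_⟩
  rw [hδ.1 U V h s, Submodule.pow_one]
  rw [Submodule.pow_succ, Submodule.pow_one] at hV
  generalize X.res h s = t at hV
  induction hV using Submodule.mul_induction_on' with
  | mem_mul_mem m hm n hn =>
    rw [← X.sum_proj V m, Finset.sum_mul, map_sum]
    refine Submodule.sum_mem _ fun i _ => ?_
    rw [hδ.2.2 V i _ n (X.proj_mem V i m), ← mul_smul_comm]
    refine add_mem (Ideal.mul_mem_left _ _ hn) (right _ _ (X.proj_oddSpan V i _ hm) _)
  | add x _ y _ hx hy => rw [map_add]; exact add_mem hx hy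

end Proofs

/-- The superbracket on the Lie superalgebra `𝔡` of vector fields. -/
def bracket : X.vectorFields →ₗ[ℂ] X.vectorFields →ₗ[ℂ] X.vectorFields :=
  LinearMap.mk₂ ℂ (fun x y => ⟨X.superBracket x.1 y.1, X.superBracket_mem x.2 y.2⟩)
    (by intro x y z; ext1; simp) (by intro c x y; ext1; simp)
    (by intro x y z; ext1; simp) (by intro c x y; ext1; simp)

/-- The filtration of `𝔡`: it is `𝔡` in degrees `p ≤ -1`, and in degrees `p ≥ 0` it consists of
the vector fields `δ` that map all sections into `𝓘 ^ p` and those of `𝓘` into `𝓘 ^ (p + 1)`. -/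
def filtration (p : ℤ) : Submodule ℂ X.vectorFields where
  carrier := {δ | 0 ≤ p → ∀ U : Opens M, (∀ s : X.sec U, δ.1 U s ∈ X.oddPow p.toNat U) ∧
    (∀ s ∈ X.oddIdeal U, δ.1 U s ∈ X.oddPow (p.toNat + 1) U)}
  zero_mem' := fun _ U => ⟨fun s => by simp, fun s _ => by simp⟩
  add_mem' := fun h h' hp U => ⟨fun s => add_mem ((h hp U).1 s) ((h' hp U).1 s),
    fun s hs => add_mem ((h hp U).2 s hs) ((h' hp U).2 s hs)⟩
  smul_mem' := fun c _ h hp U =>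
    ⟨fun s => Submodule.smul_of_tower_mem (X.oddPow p.toNat U) c ((h hp U).1 s),
    fun s hs => Submodule.smul_of_tower_mem (X.oddPow (p.toNat + 1) U) c ((h hp U).2 s hs)⟩

section Proofs

theorem oddPow_zero_mem (U : Opens M) (s : X.sec U) : s ∈ X.oddPow 0 U := by
  intro w hw
  refine ⟨U, le_rfl, hw, ?_⟩
  rw [Submodule.pow_zero, Ideal.one_eq_top]; trivial

theorem mem_filtration_zero {x : X.vectorFields} :
    x ∈ X.filtration 0 ↔ ∀ U : Opens M, ∀ s ∈ X.oddIdeal U, x.1 U s ∈ X.oddIdeal U :=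
  ⟨fun h U => (h le_rfl U).2, fun h _ U => ⟨fun _ => X.oddPow_zero_mem U _, h U⟩⟩

theorem superBracket_oddIdeal (x y : X.PreEnd) (U : Opens M)
    (h : ∀ a b : ZMod 2, ∀ s ∈ X.oddIdeal U, X.part a x U (X.part b y U s) ∈ X.oddIdeal U)
    (h' : ∀ a b : ZMod 2, ∀ s ∈ X.oddIdeal U, X.part b y U (X.part a x U s) ∈ X.oddIdeal U) :
    ∀ s ∈ X.oddIdeal U, X.superBracket x y U s ∈ X.oddIdeal U := by
  intro s hs
  rw [superBracket_apply]
  simp only [Finset.sum_apply, LinearMap.sum_apply]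
  exact Submodule.sum_mem _ fun a _ => Submodule.sum_mem _ fun b _ =>
    sub_mem (h a b s hs) (Submodule.smul_of_tower_mem _ _ (h' a b s hs))

theorem bracket_filtration_zero {x y : X.vectorFields} (hx : x ∈ X.filtration 0)
    (hy : y ∈ X.filtration 0) : X.bracket x y ∈ X.filtration 0 := by
  rw [mem_filtration_zero] at *
  intro U
  have hx' := X.part_oddPow x.1 U 1 1 (hx U)
  have hy' := X.part_oddPow y.1 U 1 1 (hy U)
  exact X.superBracket_oddIdeal x.1 y.1 U (fun a b s hs => hx' a _ (hy' b s hs))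
    (fun a b s hs => hy' b _ (hx' a s hs))

theorem bracket_filtration_one {x : X.vectorFields} (hx : x ∈ X.filtration 1)
    (y : X.vectorFields) : X.bracket x y ∈ X.filtration 0 := by
  rw [mem_filtration_zero]
  intro U
  have hx0 := X.part_oddPow x.1 U 0 1 (fun s _ => (hx zero_le_one U).1 s)
  have hx1 := X.part_oddPow x.1 U 1 2 (hx zero_le_one U).2
  exact X.superBracket_oddIdeal x.1 y.1 U (fun a b s _ => hx0 a _ (X.oddPow_zero_mem U _))
    (fun a b s hs => X.superDer_oddPow_two (X.part_mem_superDer y.2 b) U _ (hx1 a s hs))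

end Proofs

/-- The adjoint action of `𝔡_0 = 𝔡_(0) / 𝔡_(1)` on `𝔡_{-1} = 𝔡 / 𝔡_(0)` induced by the
superbracket. -/
def grAdjoint : (X.filtration 0 ⧸ (X.filtration 1).submoduleOf (X.filtration 0)) →ₗ[ℂ]
    Module.End ℂ (X.vectorFields ⧸ X.filtration 0) :=
  Submodule.liftQ _
    { toFun := fun x => Submodule.mapQ _ _ (X.bracket x.1)
        (fun _ hy => X.bracket_filtration_zero x.2 hy)
      map_add' := by
        intro x y; ext z; simp
      map_smul' := by
        intro c x; ext z; simp }
    (by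
      intro x hx
      ext z
      have h : X.bracket x.1 z ∈ X.filtration 0 := X.bracket_filtration_one hx z
      simpa using h)

/-! ### The odd tangent bundle -/

/-- The section `f` over `U` takes the value `c` at the point `w ∈ U`: the germ of `f - c` at `w`
is not invertible. -/
def HasValue {U : Opens M} (f : X.sec U) (w : M) (c : ℂ) : Prop :=
  ∀ (V : Opens M) (h : V ≤ U), w ∈ V → ¬ IsUnit (X.res h f - algebraMap ℂ (X.sec V) c)

/-- The fibre at `w` of the odd tangent bundle, that is, of the vector bundle with the sheaf of
sections `(𝓘 / 𝓘 ^ 2)^*`: linear functionals on the stalk of `𝓘` at `w` that vanish on the products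
`f s` where `f` vanishes at `w` and `s` is in the stalk of `𝓘` (so they vanish on `𝓘 ^ 2`).
A functional on a stalk is given by a family of functionals, compatible with restrictions, on
the sections over the open neighbourhoods of `w`. -/
@[ext]
structure OddTangent (w : M) where
  toFun : ∀ U : Opens M, w ∈ U → (X.oddIdeal U →ₗ[ℂ] ℂ)
  map_res : ∀ (U V : Opens M) (h : V ≤ U) (hw : w ∈ V) (s : X.oddIdeal U),
    toFun V hw ⟨X.res h s, X.res_oddPow h 1 s s.2⟩ = toFun U (h hw) s
  map_smul_of_vanish : ∀ (U : Opens M) (hw : w ∈ U) (f : X.sec U) (s : X.oddIdeal U),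
    X.HasValue f w 0 → toFun U hw (f • s) = 0

/-- A global holomorphic section of the odd tangent bundle: a choice of a vector in each fibre
whose pairing with every local section of `𝓘` is a holomorphic function. -/
structure OddSection where
  val : ∀ w : M, X.OddTangent w
  holomorphic : ∀ (U : Opens M) (s : X.oddIdeal U) (w : M), w ∈ U →
    ∃ (V : Opens M) (hV : V ≤ U), w ∈ V ∧ ∃ g : X.sec V,
      ∀ (w' : M) (hw' : w' ∈ V), X.HasValue g w' ((val w').toFun U (hV hw') s)

/-- The subspace `𝔡_{-1} = 𝔡 / 𝔡_(0)` of the space of global sections of the odd tangent bundle: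
the vector field `γ` defines the section whose pairing with `s` in `𝓘` is the value
of `γ(s)`. -/
def inducedSections : Set X.OddSection :=
  {σ | ∃ γ ∈ X.vectorFields, ∀ (U : Opens M) (s : X.oddIdeal U) (w : M) (hw : w ∈ U),
    X.HasValue (γ U s) w ((σ.val w).toFun U hw s)}

end SuperSpace

/-! ### Transitivity -/

/-- Transitivity of a filtered algebra with the bracket `br` and the filtration `F`. -/
def IsTransitiveFiltered {L : Type*} [AddCommGroup L] [Module ℂ L] (br : L →ₗ[ℂ] L →ₗ[ℂ] L)
    (F : ℤ → Submodule ℂ L) : Prop :=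
  ∀ p : ℤ, 0 ≤ p → (F (p + 1) : Set L) = {x | x ∈ F p ∧ ∀ y, br x y ∈ F p}

/-- The transitivity condition in degree `p` for an algebra with the bracket `br` and the
grading `G`: the elements of degree `p` that commute with all elements of negative
degrees vanish. -/
def TransitiveInDegree {L : Type*} [AddCommGroup L] [Module ℂ L] (br : L →ₗ[ℂ] L →ₗ[ℂ] L)
    (G : ℤ → Submodule ℂ L) (p : ℤ) : Prop :=
  ∀ x ∈ G p, (∀ y ∈ ⨆ q : ℤ, ⨆ _ : q < 0, G q, br x y = 0) → x = 0

/-- Transitivity of a graded algebra with the bracket `br` and the grading `G`. -/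
def IsTransitiveGraded {L : Type*} [AddCommGroup L] [Module ℂ L] (br : L →ₗ[ℂ] L →ₗ[ℂ] L)
    (G : ℤ → Submodule ℂ L) : Prop :=
  ∀ p : ℤ, 0 ≤ p → TransitiveInDegree br G p

/-! ### Model superspaces and complex supermanifolds -/

/-- Holomorphic functions on an open subset of `ℂ ^ n`. -/
def holo (n : ℕ) (V : Opens (Fin n → ℂ)) : Subalgebra ℂ (V → ℂ) where
  carrier := {f | ∃ g : (Fin n → ℂ) → ℂ, DifferentiableOn ℂ g V ∧ ∀ x : V, f x = g x}
  mul_mem' := by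
    rintro f f' ⟨g, hg, h⟩ ⟨g', hg', h'⟩
    exact ⟨g * g', hg.mul hg', fun x => by simp [h, h']⟩
  add_mem' := by
    rintro f f' ⟨g, hg, h⟩ ⟨g', hg', h'⟩
    exact ⟨g + g', hg.add hg', fun x => by simp [h, h']⟩
  algebraMap_mem' := fun c => ⟨fun _ => c, differentiableOn_const c, fun x => rfl⟩

/-- Restriction of holomorphic functions. -/
def holoRes (n : ℕ) {V W : Opens (Fin n → ℂ)} (h : W ≤ V) : holo n V →ₐ[ℂ] holo n W where
  toFun f := ⟨fun x => f.1 ⟨x.1, h x.2⟩, by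
    obtain ⟨g, hg, hf⟩ := f.2
    exact ⟨g, hg.mono h, fun x => hf _⟩⟩
  map_one' := rfl
  map_mul' _ _ := rfl
  map_zero' := rfl
  map_add' _ _ := rfl
  commutes' _ := rfl

/-- Sections over `V` of the structure sheaf `Λ_𝓞[ξ_1, …, ξ_m]` of the model superspace of
dimension `n|m`. -/
abbrev ModelSec (n m : ℕ) (V : Opens (Fin n → ℂ)) : Type :=
  holo n V ⊗[ℂ] ExteriorAlgebra ℂ (Fin m → ℂ)

/-- Restriction of sections on the model superspace. -/
def modelRes (n m : ℕ) {V W : Opens (Fin n → ℂ)} (h : W ≤ V) :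
    ModelSec n m V →ₐ[ℂ] ModelSec n m W :=
  Algebra.TensorProduct.map (holoRes n h) (AlgHom.id ℂ _)

/-- Sections of degree `q` in the variables `ξ` on the model superspace. -/
def modelDeg (n m : ℕ) (V : Opens (Fin n → ℂ)) (q : ℤ) : Submodule ℂ (ModelSec n m V) :=
  if 0 ≤ q then LinearMap.range (LinearMap.lTensor (holo n V) (⋀[ℂ]^q.toNat (Fin m → ℂ)).subtype)
  else ⊥

/-- Sections of parity `i` on the model superspace: all the `ξ` are odd. -/
def modelParity (n m : ℕ) (V : Opens (Fin n → ℂ)) (i : ZMod 2) : Submodule ℂ (ModelSec n m V) :=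
  ⨆ q : ℤ, ⨆ _ : (q : ZMod 2) = i, modelDeg n m V q

/-- The image of an open subset of the domain of a chart. -/
def chartImage {M : Type u} [TopologicalSpace M] {n : ℕ}
    (e : OpenPartialHomeomorph M (Fin n → ℂ)) (W : Opens M) (h : (W : Set M) ⊆ e.source) :
    Opens (Fin n → ℂ) :=
  ⟨e '' W, e.isOpen_image_of_subset_source W.2 h⟩

theorem chartImage_mono {M : Type u} [TopologicalSpace M] {n : ℕ}
    (e : OpenPartialHomeomorph M (Fin n → ℂ)) {W W' : Opens M} (h : (W : Set M) ⊆ e.source)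
    (hW : W' ≤ W) : chartImage e W' (Set.Subset.trans hW h) ≤ chartImage e W h :=
  Set.image_mono hW

/-- A chart of dimension `n|m`: an isomorphism, as spaces with sheaves of superalgebras, of an
open subset of `M` onto an open subset of the model superspace. -/
structure SuperChart {M : Type u} [TopologicalSpace M] (X : SuperSpace M) (n m : ℕ) where
  base : OpenPartialHomeomorph M (Fin n → ℂ)
  iso : ∀ (W : Opens M) (h : (W : Set M) ⊆ base.source),
    X.sec W ≃ₐ[ℂ] ModelSec n m (chartImage base W h)
  iso_res : ∀ (W W' : Opens M) (h : (W : Set M) ⊆ base.source) (hW : W' ≤ W) (s : X.sec W),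
    iso W' (Set.Subset.trans hW h) (X.res hW s) =
      modelRes n m (chartImage_mono base h hW) (iso W h s)
  iso_parity : ∀ (W : Opens M) (h : (W : Set M) ⊆ base.source) (i : ZMod 2) (s : X.sec W),
    s ∈ X.parity W i ↔ iso W h s ∈ modelParity n m _ i

/-- `X` is a complex supermanifold of dimension `n|m`. -/
def IsSupermanifold {M : Type u} [TopologicalSpace M] (X : SuperSpace M) (n m : ℕ) : Prop :=
  ∀ w : M, ∃ c : SuperChart X n m, w ∈ c.base.source

/-- The structure of a split supermanifold of dimension `n|m`, that is, an identification of the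
structure sheaf with `Λ_𝓞(𝓕)` for a locally free sheaf `𝓕` of rank `m` on a complex manifold of
dimension `n`. It is given by the corresponding `ℤ`-grading of the structure sheaf, which
is locally isomorphic to the grading of `Λ_𝓞[ξ_1, …, ξ_m]` by the degree in the `ξ`; then `𝓞` and
`𝓕` are the components of degrees `0` and `1`. -/
structure SplitStructure {M : Type u} [TopologicalSpace M] (X : SuperSpace M) (n m : ℕ) where
  deg : ∀ U : Opens M, ℤ → Submodule ℂ (X.sec U)
  graded : ∀ U : Opens M, GradedAlgebra (deg U)
  res_deg : ∀ {U V : Opens M} (h : V ≤ U) (q : ℤ) (s : X.sec U), s ∈ deg U q → X.res h s ∈ deg V q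
  deg_le_parity : ∀ (U : Opens M) (q : ℤ), deg U q ≤ X.parity U (q : ZMod 2)
  exists_chart : ∀ w : M, ∃ c : SuperChart X n m, w ∈ c.base.source ∧
    ∀ (W : Opens M) (h : (W : Set M) ⊆ c.base.source) (q : ℤ) (s : X.sec W),
      s ∈ deg W q ↔ c.iso W h s ∈ modelDeg n m _ q

namespace SplitStructure

variable {M : Type u} [TopologicalSpace M] {X : SuperSpace M} {n m : ℕ} (S : SplitStructure X n m)

/-- The component `𝔡_p` of the Lie superalgebra of vector fields on a split supermanifold: the
vector fields that raise degrees of sections by `p`. -/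
def component (p : ℤ) : Submodule ℂ X.vectorFields where
  carrier := {δ | ∀ (U : Opens M) (q : ℤ), ∀ s ∈ S.deg U q, δ.1 U s ∈ S.deg U (q + p)}
  zero_mem' := fun U q s _ => by simp
  add_mem' := fun h h' U q s hs => add_mem (h U q s hs) (h' U q s hs)
  smul_mem' := fun c _ h U q s hs => Submodule.smul_mem _ c (h U q s hs)

theorem part_deg (T : X.PreEnd) (U : Opens M) (q p : ℤ) (s : X.sec U) (hs : s ∈ S.deg U q)
    (hT : T U s ∈ S.deg U (q + p)) (a : ZMod 2) : X.part a T U s ∈ S.deg U (q + p) := by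
  have h : X.part a T U s = ∑ b : ZMod 2, X.proj U (a + b) (T U (X.proj U b s)) := by
    simp [SuperSpace.part]
  rw [h]
  refine Submodule.sum_mem _ fun b _ => ?_
  rw [X.proj_of_mem (S.deg_le_parity U q hs)]
  split_ifs
  · rw [X.proj_of_mem (S.deg_le_parity U _ hT)]
    split_ifs
    · exact hT
    · exact zero_mem _
  · simp

theorem bracket_component {p r : ℤ} {x y : X.vectorFields} (hx : x ∈ S.component p)
    (hy : y ∈ S.component r) : X.bracket x y ∈ S.component (p + r) := by
  intro U q s hs
  change X.superBracket x.1 y.1 U s ∈ _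
  rw [X.superBracket_apply]
  simp only [Finset.sum_apply, LinearMap.sum_apply]
  refine Submodule.sum_mem _ fun a _ => Submodule.sum_mem _ fun b _ =>
    sub_mem ?_ (Submodule.smul_mem _ _ ?_)
  · have h := S.part_deg y.1 U q r s hs (hy U q s hs) b
    have h' := S.part_deg x.1 U _ p _ h (hx U _ _ h) a
    rwa [add_assoc, add_comm r p] at h'
  · have h := S.part_deg x.1 U q p s hs (hx U q s hs) a
    have h' := S.part_deg y.1 U _ r _ h (hy U _ _ h) b
    rwa [add_assoc] at h'

/-- The adjoint representation of `𝔡_0` in `𝔡_{-1}`. -/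
def adjoint : S.component 0 →ₗ[ℂ] Module.End ℂ (S.component (-1)) where
  toFun x := (X.bracket x.1).restrict
    (fun y hy => by simpa using S.bracket_component x.2 hy)
  map_add' x y := by ext1 z; ext1; simp
  map_smul' c x := by ext1 z; ext1; simp

end SplitStructure

/-! ### Contractions in the exterior algebra -/

/-! Evaluating the even coordinates of a chart at a point `w` and keeping the odd ones turns
sections into elements of the exterior algebra of ℂ^m (`evAt`). The power 𝓘^k is detected pointwise
by the filtration `degGE` (`evAt_mem_degGE`, `mem_oddSpan_pow_of_evAt`), and odd tangent vectors at
`w` are the functionals φ on ℂ^m, pairing with 𝓘 through contraction (`tangent`, `coords`). The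
algebraic core is the Euler operator ∑ e_j ∧ (e_j^* ⌟ a), which is multiplication by k in degree k.
Hence in positive degree an element all of whose contractions vanish is zero
(`eq_zero_of_contr_eq_zero`), and an element of `degGE V k`, k > 0, all of whose contractions stay
in `degGE V k` lies in `degGE V (k + 1)` (`mem_degGE_succ_of_contr_mem`).

Filtered case. Let γ be a vector field with value φ at `w`. Its even part preserves 𝓘, so its odd
part y already has value φ; on 𝓘^k, y acts at `w` as contraction with φ modulo degree k
(`evAt_sub_contr_mem`). Therefore a section of 𝓘^k, k > 0, that all such y map into 𝓘^k lies in
𝓘^(k+1) (`mem_oddPow_succ`). Write x' = x_0 - x_1 for the parity twist of x, so that y x' = x y -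
[x, y] for odd y. If x and all [x, y] are in 𝔡_(k) with k > 0, then y x' sends every section into
𝓘^k, so x', and with it x, sends every section into 𝓘^(k+1). Using this for the term x y, the same
argument on 𝓘 gains the second inclusion. For k = 0 the claim is faithfulness of the adjoint action;
the reverse inclusion is the Leibniz rule.

Split case. Each global section σ of the odd tangent bundle lifts exactly to a vector field of
degree -1, contraction with σ (`contrField`): between adapted charts the values at a point are
related by an algebra endomorphism preserving degree one, so local contractions agree and glue. If x
of degree p > 0 commutes with all of them, then contractions of x's on a degree 0 section s vanish,
so x' and both parts of x kill s; the same follows for degree 1, since contraction lands in degree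
0. Degrees 0 and 1 determine a superderivation, so x = 0. Degree p = 0 is again faithfulness. -/

namespace ExteriorAlgebra

section Contraction

variable {V : Type*} [AddCommGroup V] [Module ℂ V]

/-- Contraction of an element of the exterior algebra with a functional. -/
def contr (φ : Module.Dual ℂ V) : ExteriorAlgebra ℂ V →ₗ[ℂ] ExteriorAlgebra ℂ V :=
  CliffordAlgebra.contractLeft (Q := (0 : QuadraticForm ℂ V)) φ

/-- The parity automorphism of the exterior algebra. -/
def sgn : ExteriorAlgebra ℂ V →ₐ[ℂ] ExteriorAlgebra ℂ V :=
  CliffordAlgebra.involute (Q := (0 : QuadraticForm ℂ V))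

theorem sgn_ι (v : V) : sgn (ι ℂ v) = -ι ℂ v := CliffordAlgebra.involute_ι v

theorem contr_ι_mul (φ : Module.Dual ℂ V) (v : V) (b : ExteriorAlgebra ℂ V) :
    contr φ (ι ℂ v * b) = φ v • b - ι ℂ v * contr φ b :=
  CliffordAlgebra.contractLeft_ι_mul (Q := (0 : QuadraticForm ℂ V)) (d := φ) v b

theorem contr_ι (φ : Module.Dual ℂ V) (v : V) :
    contr φ (ι ℂ v) = algebraMap ℂ _ (φ v) :=
  CliffordAlgebra.contractLeft_ι (Q := (0 : QuadraticForm ℂ V)) (d := φ) v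

theorem contr_algebraMap (φ : Module.Dual ℂ V) (c : ℂ) : contr φ (algebraMap ℂ _ c) = 0 :=
  CliffordAlgebra.contractLeft_algebraMap (Q := (0 : QuadraticForm ℂ V)) (d := φ) c

theorem contr_smul_left (c : ℂ) (φ : Module.Dual ℂ V) (a : ExteriorAlgebra ℂ V) :
    contr (c • φ) a = c • contr φ a := by
  simp [contr]

theorem contr_sum_left {κ : Type*} (s : Finset κ) (φ : κ → Module.Dual ℂ V)
    (a : ExteriorAlgebra ℂ V) : contr (∑ i ∈ s, φ i) a = ∑ i ∈ s, contr (φ i) a := by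
  simp [contr]

theorem exteriorPower_zero_eq : ⋀[ℂ]^0 V = 1 := pow_zero _

theorem exteriorPower_one_eq : ⋀[ℂ]^1 V = LinearMap.range (ι ℂ) := pow_one _

theorem exteriorPower_succ_eq (k : ℕ) :
    ⋀[ℂ]^(k + 1) V = LinearMap.range (ι ℂ) * ⋀[ℂ]^k V := pow_succ' _ k

theorem exteriorPower_add_eq (k l : ℕ) : ⋀[ℂ]^(k + l) V = ⋀[ℂ]^k V * ⋀[ℂ]^l V := pow_add _ k l

theorem ι_mem_exteriorPower_one (v : V) : ι ℂ v ∈ ⋀[ℂ]^1 V := by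
  rw [exteriorPower_one_eq]; exact ⟨v, rfl⟩

/-- Contraction is an odd superderivation. -/
theorem contr_mul (φ : Module.Dual ℂ V) (a b : ExteriorAlgebra ℂ V) :
    contr φ (a * b) = contr φ a * b + sgn a * contr φ b := by
  induction a using ExteriorAlgebra.induction generalizing b with
  | algebraMap r => simp [contr_algebraMap, ← Algebra.smul_def]
  | ι v => rw [contr_ι_mul, contr_ι, sgn_ι, Algebra.smul_def, neg_mul, sub_eq_add_neg]
  | mul a a' h h' =>
    rw [mul_assoc, h, h', h a', map_mul]
    simp only [mul_add, add_mul, mul_assoc, add_assoc]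
  | add a a' h h' =>
    rw [add_mul, map_add, h, h', map_add, map_add]
    simp only [add_mul]
    abel

theorem contr_mem_exteriorPower (φ : Module.Dual ℂ V) (k : ℕ) (a : ExteriorAlgebra ℂ V)
    (ha : a ∈ ⋀[ℂ]^(k + 1) V) : contr φ a ∈ ⋀[ℂ]^k V := by
  induction k generalizing a with
  | zero =>
    rw [zero_add, exteriorPower_one_eq] at ha
    obtain ⟨v, rfl⟩ := ha
    rw [contr_ι, exteriorPower_zero_eq]
    exact Submodule.mem_one.mpr ⟨φ v, rfl⟩
  | succ k ih =>
    rw [exteriorPower_succ_eq] at ha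
    induction ha using Submodule.mul_induction_on' with
    | mem_mul_mem x hx b hb =>
      obtain ⟨v, rfl⟩ := hx
      rw [contr_ι_mul]
      refine sub_mem (Submodule.smul_mem _ _ hb) ?_
      rw [exteriorPower_succ_eq]
      exact Submodule.mul_mem_mul ⟨v, rfl⟩ (ih b hb)
    | add x _ y _ hx hy => rw [map_add]; exact add_mem hx hy

theorem contr_of_mem_exteriorPower_zero (φ : Module.Dual ℂ V) (a : ExteriorAlgebra ℂ V)
    (ha : a ∈ ⋀[ℂ]^0 V) : contr φ a = 0 := by
  rw [exteriorPower_zero_eq] at ha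
  obtain ⟨c, rfl⟩ := Submodule.mem_one.mp ha
  exact contr_algebraMap φ c

theorem sgn_of_mem_exteriorPower (k : ℕ) (a : ExteriorAlgebra ℂ V) (ha : a ∈ ⋀[ℂ]^k V) :
    sgn a = (-1 : ℂ) ^ k • a := by
  induction k generalizing a with
  | zero =>
    rw [exteriorPower_zero_eq] at ha
    obtain ⟨c, rfl⟩ := Submodule.mem_one.mp ha
    simp
  | succ k ih =>
    rw [exteriorPower_succ_eq] at ha
    induction ha using Submodule.mul_induction_on' with
    | mem_mul_mem x hx b hb =>
      obtain ⟨v, rfl⟩ := hx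
      rw [map_mul, sgn_ι, ih b hb, pow_succ]
      simp
    | add x _ y _ hx hy => rw [map_add, hx, hy, smul_add]

/-! ### The decreasing degree filtration of the exterior algebra -/

/-- The ideal of elements without components of degrees less than `k`. -/
def degGE (V : Type*) [AddCommGroup V] [Module ℂ V] (k : ℕ) : Submodule ℂ (ExteriorAlgebra ℂ V) :=
  ⊤ * ⋀[ℂ]^k V

/-- Both sides are the sum of all exterior powers of degree at least one. This is what makes the
left ideals `degGE V k` two-sided and multiplicative. -/
theorem range_ι_mul_top : LinearMap.range (ι ℂ (M := V)) * ⊤ = ⊤ * LinearMap.range (ι ℂ (M := V)) := by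
  have h : (⊤ : Submodule ℂ (ExteriorAlgebra ℂ V)) = ⨆ k : ℕ, ⋀[ℂ]^k V :=
    (DirectSum.Decomposition.isInternal (fun k : ℕ => ⋀[ℂ]^k V)).submodule_iSup_eq_top.symm
  rw [h, Submodule.mul_iSup, Submodule.iSup_mul]
  exact iSup_congr fun k => by rw [← exteriorPower_succ_eq, exteriorPower_add_eq, exteriorPower_one_eq]

theorem exteriorPower_mul_top (k : ℕ) : ⋀[ℂ]^k V * ⊤ = ⊤ * ⋀[ℂ]^k V := by
  induction k with
  | zero => rw [exteriorPower_zero_eq, one_mul, mul_one]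
  | succ k ih =>
    rw [exteriorPower_add_eq, exteriorPower_one_eq, mul_assoc, range_ι_mul_top, ← mul_assoc, ih,
      mul_assoc]

theorem top_mul_top :
    (⊤ : Submodule ℂ (ExteriorAlgebra ℂ V)) * ⊤ = ⊤ :=
  eq_top_iff.mpr fun a _ => by
    simpa using Submodule.mul_mem_mul (Submodule.mem_top (R := ℂ) (x := a))
      (Submodule.mem_top (R := ℂ) (x := (1 : ExteriorAlgebra ℂ V)))

theorem degGE_mul (k l : ℕ) : degGE V k * degGE V l = degGE V (k + l) := by
  rw [degGE, degGE, degGE, mul_assoc, ← mul_assoc (⋀[ℂ]^k V), exteriorPower_mul_top, mul_assoc,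
    ← exteriorPower_add_eq, ← mul_assoc, top_mul_top]

theorem degGE_zero : degGE V 0 = ⊤ := by rw [degGE, exteriorPower_zero_eq, mul_one]

theorem mul_mem_degGE_left (k : ℕ) {a b : ExteriorAlgebra ℂ V} (hb : b ∈ degGE V k) :
    a * b ∈ degGE V k := by
  have := Submodule.mul_mem_mul (show a ∈ degGE V 0 by rw [degGE_zero]; trivial) hb
  rwa [degGE_mul, zero_add] at this

theorem mul_mem_degGE_right (k : ℕ) {a b : ExteriorAlgebra ℂ V} (ha : a ∈ degGE V k) :
    a * b ∈ degGE V k := by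
  have := Submodule.mul_mem_mul ha (show b ∈ degGE V 0 by rw [degGE_zero]; trivial)
  rwa [degGE_mul, add_zero] at this

theorem exteriorPower_le_degGE (k : ℕ) : ⋀[ℂ]^k V ≤ degGE V k := fun a ha => by
  have := Submodule.mul_mem_mul (Submodule.mem_top (R := ℂ) (x := (1 : ExteriorAlgebra ℂ V))) ha
  rwa [one_mul] at this

theorem degGE_succ_le (k : ℕ) : degGE V (k + 1) ≤ degGE V k := by
  rw [add_comm, ← degGE_mul]
  exact Submodule.mul_le.mpr fun a _ b hb => mul_mem_degGE_left k hb

/-- An element of `degGE V k` is the sum of an element of degree `k` and an element of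
`degGE V (k + 1)`. -/
theorem degGE_le_sup (k : ℕ) : degGE V k ≤ ⋀[ℂ]^k V ⊔ degGE V (k + 1) := by
  -- Every element is a scalar modulo the augmentation ideal. Applied to the left factor of a
  -- product a * b with b of degree k, this splits off the leading term c • b.
  have h : ∀ a : ExteriorAlgebra ℂ V, ∃ c : ℂ, a - algebraMap ℂ _ c ∈ degGE V 1 := by
    intro a
    induction a using ExteriorAlgebra.induction with
    | algebraMap r => exact ⟨r, by simp⟩
    | ι v => exact ⟨0, by simpa using exteriorPower_le_degGE 1 (ι_mem_exteriorPower_one v)⟩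
    | mul a b ha hb =>
      obtain ⟨c, hc⟩ := ha
      obtain ⟨d, hd⟩ := hb
      refine ⟨c * d, ?_⟩
      have : a * b - algebraMap ℂ _ (c * d) =
          (a - algebraMap ℂ _ c) * b + algebraMap ℂ _ c * (b - algebraMap ℂ _ d) := by
        rw [map_mul]; noncomm_ring
      rw [this]
      exact add_mem (mul_mem_degGE_right 1 hc) (mul_mem_degGE_left 1 hd)
    | add a b ha hb =>
      obtain ⟨c, hc⟩ := ha
      obtain ⟨d, hd⟩ := hb
      refine ⟨c + d, ?_⟩
      rw [map_add, add_sub_add_comm]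
      exact add_mem hc hd
  refine Submodule.mul_le.mpr fun a _ b hb => ?_
  obtain ⟨c, hc⟩ := h a
  have : a * b = c • b + (a - algebraMap ℂ _ c) * b := by rw [Algebra.smul_def]; noncomm_ring
  rw [this]
  refine Submodule.add_mem_sup (Submodule.smul_mem _ _ hb) ?_
  rw [add_comm k 1, ← degGE_mul]
  exact Submodule.mul_mem_mul hc (exteriorPower_le_degGE k hb)

theorem algebraMapInv_of_mem_degGE_one {a : ExteriorAlgebra ℂ V} (ha : a ∈ degGE V 1) :
    algebraMapInv a = 0 := by
  rw [degGE, exteriorPower_one_eq] at ha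
  induction ha using Submodule.mul_induction_on' with
  | mem_mul_mem x hx b hb =>
    obtain ⟨v, rfl⟩ := hb
    simp [algebraMapInv]
  | add x _ y _ hx hy => rw [map_add, hx, hy, add_zero]

/-- The first step of the filtration is the augmentation ideal, so membership is tested by a single
complex number, the value of a section at a point. -/
theorem mem_degGE_one_iff {a : ExteriorAlgebra ℂ V} : a ∈ degGE V 1 ↔ algebraMapInv a = 0 := by
  refine ⟨algebraMapInv_of_mem_degGE_one, fun h => ?_⟩
  have ha : a ∈ degGE V 0 := by rw [degGE_zero]; trivial
  obtain ⟨b, hb, c, hc, rfl⟩ := Submodule.mem_sup.mp (degGE_le_sup 0 ha)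
  rw [exteriorPower_zero_eq] at hb
  obtain ⟨r, rfl⟩ := Submodule.mem_one.mp hb
  rw [zero_add] at hc
  rw [map_add, algebraMapInv_of_mem_degGE_one hc, AlgHom.commutes, add_zero] at h
  rw [show r = 0 from h]
  simpa using hc

theorem algebraMapInv_sgn (a : ExteriorAlgebra ℂ V) :
    algebraMapInv (sgn a) = algebraMapInv a := by
  have : (algebraMapInv (R := ℂ) (M := V)).comp sgn = algebraMapInv := by
    ext v
    simp [sgn_ι, algebraMapInv]
  exact DFunLike.congr_fun this a

variable {κ : Type*} [Fintype κ]

/-- The Euler operator `∑ e_j ∧ (e_j^* ⌟ a)` multiplies elements of degree `k` by `k`. -/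
theorem euler_of_mem_exteriorPower (e : Module.Basis κ ℂ V) (k : ℕ) (a : ExteriorAlgebra ℂ V)
    (ha : a ∈ ⋀[ℂ]^k V) : ∑ j, ι ℂ (e j) * contr (e.coord j) a = (k : ℂ) • a := by
  induction k generalizing a with
  | zero => simp [contr_of_mem_exteriorPower_zero _ a ha]
  | succ k ih =>
    rw [exteriorPower_succ_eq] at ha
    induction ha using Submodule.mul_induction_on' with
    | mem_mul_mem x hx b hb =>
      obtain ⟨v, rfl⟩ := hx
      have h1 : ∀ j, ι ℂ (e j) * contr (e.coord j) (ι ℂ v * b) =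
          (ι ℂ (e.repr v j • e j)) * b + ι ℂ v * (ι ℂ (e j) * contr (e.coord j) b) := by
        intro j
        -- Moving e_j past v changes the sign, which cancels the sign in the contraction formula:
        -- the Euler operator is an even derivation.
        have h2 : ι ℂ (e j) * ι ℂ v = - (ι ℂ v * ι ℂ (e j)) :=
          eq_neg_of_add_eq_zero_left (ι_add_mul_swap _ _)
        rw [contr_ι_mul, mul_sub, ← mul_assoc, h2, ← mul_assoc]
        simp
      simp only [h1, Finset.sum_add_distrib, ← Finset.sum_mul, ← Finset.mul_sum, ih b hb,
        ← map_sum, e.sum_repr]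
      push_cast
      rw [add_smul, one_smul, mul_smul_comm, add_comm]
    | add x _ y _ hx hy => simp only [map_add, mul_add, Finset.sum_add_distrib, hx, hy, smul_add]

theorem contr_mem_degGE (φ : Module.Dual ℂ V) (k : ℕ) {a : ExteriorAlgebra ℂ V}
    (ha : a ∈ degGE V (k + 1)) : contr φ a ∈ degGE V k := by
  rw [degGE] at ha
  induction ha using Submodule.mul_induction_on' with
  | mem_mul_mem x hx b hb =>
    rw [contr_mul]
    exact add_mem (degGE_succ_le k (mul_mem_degGE_left (k + 1) (exteriorPower_le_degGE _ hb)))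
      (mul_mem_degGE_left k (exteriorPower_le_degGE _ (contr_mem_exteriorPower φ k b hb)))
  | add x _ y _ hx hy => rw [map_add]; exact add_mem hx hy

/-- The Euler operator is built from contractions and multiplies by the nonzero number k. -/
theorem eq_zero_of_contr_eq_zero (e : Module.Basis κ ℂ V) {k : ℕ} (hk : k ≠ 0)
    {a : ExteriorAlgebra ℂ V} (ha : a ∈ ⋀[ℂ]^k V) (h : ∀ φ, contr φ a = 0) : a = 0 := by
  have := euler_of_mem_exteriorPower e k a ha
  simp only [h, mul_zero, Finset.sum_const_zero] at this
  exact (smul_eq_zero.mp this.symm).resolve_left (by exact_mod_cast hk)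

/-- Only the leading term b of degree k matters. By the Euler formula k • b is a sum of products of
e_j with contractions of b; if these lie in degree at least k, the products lie in degree at least k
+ 1, and k is invertible. -/
theorem mem_degGE_succ_of_contr_mem (e : Module.Basis κ ℂ V) {k : ℕ} (hk : k ≠ 0)
    {a : ExteriorAlgebra ℂ V} (ha : a ∈ degGE V k) (h : ∀ φ, contr φ a ∈ degGE V k) :
    a ∈ degGE V (k + 1) := by
  obtain ⟨b, hb, c, hc, rfl⟩ := Submodule.mem_sup.mp (degGE_le_sup k ha)
  refine add_mem ?_ hc
  have hb' : ∀ φ, contr φ b ∈ degGE V k := fun φ => by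
    have := sub_mem (h φ) (contr_mem_degGE φ k hc)
    rwa [map_add, add_sub_cancel_right] at this
  have := euler_of_mem_exteriorPower e k b hb
  have h2 : (k : ℂ) • b ∈ degGE V (k + 1) := by
    rw [← this, add_comm, ← degGE_mul]
    exact Submodule.sum_mem _ fun j _ => Submodule.mul_mem_mul
      (exteriorPower_le_degGE 1 (ι_mem_exteriorPower_one _)) (hb' _)
  have hk' : (k : ℂ) ≠ 0 := by exact_mod_cast hk
  simpa [smul_smul, hk'] using Submodule.smul_mem _ ((k : ℂ)⁻¹) h2

theorem degGE_eq_bot [Module.Finite ℂ V] {k : ℕ} (hk : Module.finrank ℂ V < k) :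
    degGE V k = ⊥ := by
  have h : ⋀[ℂ]^k V = ⊥ := by
    rw [← Submodule.finrank_eq_zero, exteriorPower.finrank_eq, Nat.choose_eq_zero_of_lt hk]
  rw [degGE, h, Submodule.mul_bot]

/-- An algebra homomorphism intertwines contractions if it does so on generators. -/
theorem contr_algHom {W : Type*} [AddCommGroup W] [Module ℂ W]
    (θ : ExteriorAlgebra ℂ V →ₐ[ℂ] ExteriorAlgebra ℂ W) (φ : Module.Dual ℂ V)
    (ψ : Module.Dual ℂ W) (h : ∀ v, ∃ w, θ (ι ℂ v) = ι ℂ w ∧ ψ w = φ v)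
    (a : ExteriorAlgebra ℂ V) : θ (contr φ a) = contr ψ (θ a) := by
  -- The Leibniz rule for contraction involves the parity automorphism, so compatibility with both
  -- is proved in one induction.
  suffices H : ∀ a, θ (contr φ a) = contr ψ (θ a) ∧ θ (sgn a) = sgn (θ a) from (H a).1
  intro a
  induction a using ExteriorAlgebra.induction with
  | algebraMap r => simp [contr_algebraMap]
  | ι v =>
    obtain ⟨w, hw, hw'⟩ := h v
    simp [hw, contr_ι, sgn_ι, hw']
  | mul a b ha hb => simp [contr_mul, ha, hb]
  | add a b ha hb => simp [ha, hb]

end Contraction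

end ExteriorAlgebra
/-! ### Values of sections of the model superspace at points -/

theorem neg_one_pow_zmod_two_val (q : ℤ) (hq : 0 ≤ q) :
    (-1 : ℂ) ^ ((q : ZMod 2)).val = (-1) ^ q.toNat := by
  obtain ⟨k, rfl⟩ := Int.eq_ofNat_of_zero_le hq
  simp only [Int.toNat_natCast, Int.cast_natCast, ZMod.val_natCast]
  exact (neg_one_pow_eq_pow_mod_two k).symm

section Model

variable {n m : ℕ} {V W : Opens (Fin n → ℂ)}

/-- The value of a holomorphic function at a point. -/
noncomputable def holoEval (x : V) : holo n V →ₐ[ℂ] ℂ := (Pi.evalAlgHom ℂ (fun _ : V => ℂ) x).comp (holo n V).val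

/-- The value at a point of a section of the structure sheaf of the model superspace: the even
coordinates are evaluated at the point and the odd ones are kept. -/
noncomputable def modelEv (m : ℕ) (x : V) : ModelSec n m V →ₐ[ℂ] ExteriorAlgebra ℂ (Fin m → ℂ) :=
  Algebra.TensorProduct.lift ((Algebra.ofId ℂ _).comp (holoEval x)) (AlgHom.id ℂ _)
    (fun f a => by exact Algebra.commute_algebraMap_left (holoEval x f) a)

theorem modelEv_tmul (x : V) (f : holo n V) (a : ExteriorAlgebra ℂ (Fin m → ℂ)) :
    modelEv m x (f ⊗ₜ a) = f.1 x • a := by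
  exact (Algebra.TensorProduct.lift_tmul _ _ _ f a).trans (Algebra.smul_def (f.1 x) a).symm

theorem modelEv_modelRes (h : W ≤ V) (x : W) (s : ModelSec n m V) :
    modelEv m x (modelRes n m h s) = modelEv m ⟨x.1, h x.2⟩ s := by
  induction s using TensorProduct.induction_on with
  | zero => simp
  | tmul f a =>
    rw [modelRes, Algebra.TensorProduct.map_tmul, modelEv_tmul, modelEv_tmul]
    rfl
  | add s t hs ht => simp [hs, ht]

/-- A section of the model superspace whose values lie in a given subspace has coefficients in this
subspace. -/
theorem mem_range_lTensor_of_modelEv (N : Submodule ℂ (ExteriorAlgebra ℂ (Fin m → ℂ)))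
    (s : ModelSec n m V) (h : ∀ x : V, modelEv m x s ∈ N) :
    s ∈ LinearMap.range (LinearMap.lTensor (holo n V) N.subtype) := by
  -- By right exactness of the tensor product it is enough that the image of `s` in the tensor
  -- product with the quotient by `N` vanishes.
  have hex := lTensor_exact (holo n V) (f := N.subtype) (g := N.mkQ)
    (LinearMap.exact_subtype_mkQ N) N.mkQ_surjective
  refine (hex s).mp ?_
  classical
  let b := Module.Basis.ofVectorSpace ℂ (ExteriorAlgebra ℂ (Fin m → ℂ) ⧸ N)
  refine (TensorProduct.equivFinsuppOfBasisRight b).injective ?_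
  -- In a basis of the quotient the coefficients are genuine functions on `V`, and their values at x
  -- are the coordinates of the value of the section modulo `N`.
  have key : ∀ (x : V) i (s : ModelSec n m V),
      (TensorProduct.equivFinsuppOfBasisRight b (LinearMap.lTensor (holo n V) N.mkQ s) i).1 x =
        b.repr (N.mkQ (modelEv m x s)) i := by
    intro x i s
    induction s using TensorProduct.induction_on with
    | zero => simp
    | tmul f a =>
      rw [LinearMap.lTensor_tmul, TensorProduct.equivFinsuppOfBasisRight_apply_tmul_apply,
        modelEv_tmul, map_smul, map_smul]
      simp [mul_comm]
    | add s t hs ht => simp [hs, ht]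
  ext i x
  have hz : N.mkQ (modelEv m x s) = 0 := (Submodule.Quotient.mk_eq_zero N).mpr (h x)
  rw [key, hz]
  simp

theorem eq_zero_of_modelEv (s : ModelSec n m V) (h : ∀ x : V, modelEv m x s = 0) : s = 0 := by
  obtain ⟨t, ht⟩ := mem_range_lTensor_of_modelEv ⊥ s (by simpa using h)
  have : (⊥ : Submodule ℂ (ExteriorAlgebra ℂ (Fin m → ℂ))).subtype = 0 := by
    ext a; exact (Submodule.mem_bot ℂ).mp a.2
  rw [← ht, this, LinearMap.lTensor_zero, LinearMap.zero_apply]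

theorem modelEv_mem_of_mem_range (N : Submodule ℂ (ExteriorAlgebra ℂ (Fin m → ℂ)))
    {s : ModelSec n m V} (hs : s ∈ LinearMap.range (LinearMap.lTensor (holo n V) N.subtype))
    (x : V) : modelEv m x s ∈ N := by
  obtain ⟨t, rfl⟩ := hs
  induction t using TensorProduct.induction_on with
  | zero => simp
  | tmul f a =>
    rw [LinearMap.lTensor_tmul, modelEv_tmul]
    exact Submodule.smul_mem _ _ a.2
  | add s t hs ht => rw [map_add, map_add]; exact add_mem hs ht

theorem mem_modelDeg_iff {q : ℤ} (hq : 0 ≤ q) {s : ModelSec n m V} :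
    s ∈ modelDeg n m V q ↔ ∀ x : V, modelEv m x s ∈ ⋀[ℂ]^q.toNat (Fin m → ℂ) := by
  rw [modelDeg, if_pos hq]
  exact ⟨fun h x => modelEv_mem_of_mem_range _ h x, mem_range_lTensor_of_modelEv _ s⟩

theorem eq_zero_of_mem_modelDeg {q : ℤ} (hq : q < 0) {s : ModelSec n m V}
    (hs : s ∈ modelDeg n m V q) : s = 0 := by
  rw [modelDeg, if_neg (not_le.mpr hq)] at hs
  exact (Submodule.mem_bot ℂ).mp hs

theorem sgn_modelEv {i : ZMod 2} {s : ModelSec n m V} (hs : s ∈ modelParity n m V i) (x : V) :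
    ExteriorAlgebra.sgn (modelEv m x s) = (-1 : ℂ) ^ i.val • modelEv m x s := by
  have : modelParity n m V i ≤
      LinearMap.eqLocus (ExteriorAlgebra.sgn.toLinearMap ∘ₗ (modelEv m x).toLinearMap)
        ((-1 : ℂ) ^ i.val • (modelEv m x).toLinearMap) := by
    refine iSup₂_le fun q hq s hs => ?_
    rcases lt_or_ge q 0 with h | h
    · rw [eq_zero_of_mem_modelDeg h hs]; exact zero_mem _
    · have := (mem_modelDeg_iff h).mp hs x
      subst hq
      simp only [LinearMap.mem_eqLocus, LinearMap.comp_apply, LinearMap.smul_apply,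
        AlgHom.toLinearMap_apply]
      rw [ExteriorAlgebra.sgn_of_mem_exteriorPower _ _ this, neg_one_pow_zmod_two_val q h]
  exact this hs

theorem one_tmul_ι_mem_modelParity (v : Fin m → ℂ) :
    ((1 : holo n V) ⊗ₜ[ℂ] ExteriorAlgebra.ι ℂ v) ∈ modelParity n m V 1 := by
  refine Submodule.mem_iSup_of_mem 1 (Submodule.mem_iSup_of_mem (by simp) ?_)
  rw [mem_modelDeg_iff zero_le_one]
  intro x
  rw [modelEv_tmul]
  exact Submodule.smul_mem _ _ (ExteriorAlgebra.ι_mem_exteriorPower_one v)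

/-- The holomorphic function underlying a section of the model superspace. -/
noncomputable def modelBody (n m : ℕ) (V : Opens (Fin n → ℂ)) : ModelSec n m V →ₐ[ℂ] holo n V :=
  Algebra.TensorProduct.lift (AlgHom.id ℂ _)
    ((Algebra.ofId ℂ _).comp ExteriorAlgebra.algebraMapInv) (fun _ _ => Commute.all _ _)

theorem modelBody_apply (s : ModelSec n m V) (x : V) :
    (modelBody n m V s).1 x = ExteriorAlgebra.algebraMapInv (modelEv m x s) := by
  induction s using TensorProduct.induction_on with
  | zero => simp
  | tmul f a =>
    rw [modelBody, Algebra.TensorProduct.lift_tmul, modelEv_tmul, map_smul, smul_eq_mul]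
    rfl
  | add s t hs ht => simp [hs, ht]

/-- A section of the model superspace is invertible if its underlying function has no zeros. -/
theorem isUnit_of_modelBody_ne_zero (s : ModelSec n m V)
    (h : ∀ x : V, ExteriorAlgebra.algebraMapInv (modelEv m x s) ≠ 0) : IsUnit s := by
  have hu : IsUnit (modelBody n m V s) := by
    obtain ⟨g, hg, hgs⟩ := (modelBody n m V s).2
    have hg0 : ∀ x ∈ V, g x ≠ 0 := fun x hx => by
      rw [← hgs ⟨x, hx⟩, modelBody_apply]; exact h _
    -- The underlying function has no zeros, so its pointwise inverse is holomorphic.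
    refine IsUnit.of_mul_eq_one ⟨fun x => (g x)⁻¹, fun x => (g x)⁻¹, hg.inv hg0, fun x => rfl⟩ ?_
    ext x
    change (modelBody n m V s).1 x * (g x)⁻¹ = 1
    rw [hgs, mul_inv_cancel₀ (hg0 x x.2)]
  have hu' : IsUnit ((modelBody n m V s) ⊗ₜ[ℂ] (1 : ExteriorAlgebra ℂ (Fin m → ℂ))) :=
    hu.map (Algebra.TensorProduct.includeLeft (R := ℂ) (S := ℂ))
  -- The underlying function has scalar values at points, hence is central.
  have hc : Commute (s - (modelBody n m V s) ⊗ₜ[ℂ] (1 : ExteriorAlgebra ℂ (Fin m → ℂ)))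
      ((modelBody n m V s) ⊗ₜ[ℂ] (1 : ExteriorAlgebra ℂ (Fin m → ℂ))) := by
    refine sub_eq_zero.mp (eq_zero_of_modelEv _ fun x => ?_)
    rw [map_sub, map_mul, map_mul, modelEv_tmul]
    simp
  have hn : IsNilpotent (s - (modelBody n m V s) ⊗ₜ[ℂ] (1 : ExteriorAlgebra ℂ (Fin m → ℂ))) := by
    -- The difference has values in the augmentation ideal, whose power m + 1 vanishes because there
    -- are only m odd variables. A unit plus a commuting nilpotent is a unit.
    refine ⟨m + 1, eq_zero_of_modelEv _ fun x => ?_⟩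
    have h1 : modelEv m x (s - (modelBody n m V s) ⊗ₜ[ℂ] (1 : ExteriorAlgebra ℂ (Fin m → ℂ))) ∈
        ExteriorAlgebra.degGE (Fin m → ℂ) 1 := by
      rw [ExteriorAlgebra.mem_degGE_one_iff, map_sub, modelEv_tmul, map_sub, modelBody_apply]
      simp
    have h2 : ∀ k : ℕ, modelEv m x
        (s - (modelBody n m V s) ⊗ₜ[ℂ] (1 : ExteriorAlgebra ℂ (Fin m → ℂ))) ^ k ∈
        ExteriorAlgebra.degGE (Fin m → ℂ) k := by
      intro k
      induction k with
      | zero => rw [ExteriorAlgebra.degGE_zero]; trivial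
      | succ k ih =>
        rw [pow_succ, ← ExteriorAlgebra.degGE_mul]
        exact Submodule.mul_mem_mul ih h1
    have h3 := h2 (m + 1)
    rw [ExteriorAlgebra.degGE_eq_bot (by simp)] at h3
    rw [map_pow]
    exact (Submodule.mem_bot ℂ).mp h3
  have := hn.isUnit_add_left_of_commute hu' hc
  rwa [add_sub_cancel] at this

end Model

/-! ### Locality of sections -/

namespace SuperSpace

variable {M : Type u} [TopologicalSpace M] (X : SuperSpace M)

theorem eq_of_locally_eq {U : Opens M} {s t : X.sec U}
    (h : ∀ w ∈ U, ∃ (V : Opens M) (hV : V ≤ U), w ∈ V ∧ X.res hV s = X.res hV t) : s = t := by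
  choose V hV hw hst using h
  refine TopCat.Sheaf.eq_of_locally_eq' (X := TopCat.of M) ⟨X.presheaf, X.isSheaf⟩
    (fun w : U => V w.1 w.2) U (fun w => homOfLE (hV w.1 w.2)) ?_ s t fun w => hst w.1 w.2
  intro w hwU
  exact Opens.mem_iSup.mpr ⟨⟨w, hwU⟩, hw w hwU⟩

theorem eq_zero_of_locally_eq_zero {U : Opens M} {s : X.sec U}
    (h : ∀ w ∈ U, ∃ (V : Opens M) (hV : V ≤ U), w ∈ V ∧ X.res hV s = 0) : s = 0 :=
  X.eq_of_locally_eq fun w hw => by simpa using h w hw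

theorem exists_gluing {U : Opens M} (V : U → Opens M) (hV : ∀ w, V w ≤ U) (hw : ∀ w : U, w.1 ∈ V w)
    (t : ∀ w, X.sec (V w))
    (ht : ∀ w w', X.res (inf_le_left : V w ⊓ V w' ≤ V w) (t w) =
      X.res (inf_le_right : V w ⊓ V w' ≤ V w') (t w')) :
    ∃ s : X.sec U, ∀ w, X.res (hV w) s = t w := by
  obtain ⟨s, hs, -⟩ := TopCat.Sheaf.existsUnique_gluing' (X := TopCat.of M)
    ⟨X.presheaf, X.isSheaf⟩ V U (fun w => homOfLE (hV w))
    (fun w hwU => Opens.mem_iSup.mpr ⟨⟨w, hwU⟩, hw ⟨w, hwU⟩⟩) t (fun w w' => ht w w')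
  exact ⟨s, hs⟩

theorem res_self {U : Opens M} (s : X.sec U) : X.res le_rfl s = s := by
  have : X.presheaf.map (homOfLE (le_refl U)).op = 𝟙 _ := X.presheaf.map_id _
  simp only [res, this]
  rfl

end SuperSpace

/-! ### Values of sections of a supermanifold in a chart -/

namespace SuperChart

variable {M : Type u} [TopologicalSpace M] {X : SuperSpace M} {n m : ℕ} (c : SuperChart X n m)

/-- The domain of a chart. -/
noncomputable def source : Opens M := ⟨c.base.source, c.base.open_source⟩

/-- The image under a chart of a point of an open set. -/
noncomputable def pt {W : Opens M} (h : (W : Set M) ⊆ c.base.source) (w : M) (hw : w ∈ W) :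
    chartImage c.base W h := ⟨c.base w, Set.mem_image_of_mem _ hw⟩

/-- The value of a section at a point in a chart: the even coordinates are evaluated at the
point and the odd ones are kept. -/
noncomputable def evAt (w : M) (hw : w ∈ c.source) (U : Opens M) (hU : w ∈ U) :
    X.sec U →ₐ[ℂ] ExteriorAlgebra ℂ (Fin m → ℂ) :=
  ((modelEv m (c.pt (W := U ⊓ c.source) inf_le_right w ⟨hU, hw⟩)).comp
    (c.iso (U ⊓ c.source) inf_le_right : X.sec (U ⊓ c.source) →ₐ[ℂ] _)).comp (X.res inf_le_left)

/-- The value may be computed on any smaller neighbourhood inside the chart, which is what makes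
`evAt` a function of the germ. -/
theorem evAt_eq {w : M} {U W : Opens M} (hWU : W ≤ U) (hW : (W : Set M) ⊆ c.base.source)
    (hw : w ∈ W) (s : X.sec U) :
    c.evAt w (hW hw) U (hWU hw) s = modelEv m (c.pt hW w hw) (c.iso W hW (X.res hWU s)) := by
  have h := c.iso_res (U ⊓ c.source) W inf_le_right (le_inf hWU hW) (X.res inf_le_left s)
  rw [X.res_res] at h
  rw [h, modelEv_modelRes]
  rfl

theorem evAt_res {w : M} (hw : w ∈ c.source) {U V : Opens M} (hVU : V ≤ U) (hV : w ∈ V)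
    (s : X.sec U) : c.evAt w hw V hV (X.res hVU s) = c.evAt w hw U (hVU hV) s := by
  rw [c.evAt_eq (W := V ⊓ c.source) (inf_le_left.trans hVU) inf_le_right ⟨hV, hw⟩,
    c.evAt_eq (W := V ⊓ c.source) inf_le_left inf_le_right ⟨hV, hw⟩, X.res_res]

theorem evAt_eq_self {w : M} {W : Opens M} (hW : (W : Set M) ⊆ c.base.source)
    (hw : w ∈ W) (s : X.sec W) :
    c.evAt w (hW hw) W hw s = modelEv m (c.pt hW w hw) (c.iso W hW s) := by
  rw [c.evAt_eq le_rfl hW hw, X.res_self]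

theorem evAt_iso_symm {w : M} {W : Opens M} (hW : (W : Set M) ⊆ c.base.source)
    (hw : w ∈ W) (s : ModelSec n m (chartImage c.base W hW)) :
    c.evAt w (hW hw) W hw ((c.iso W hW).symm s) = modelEv m (c.pt hW w hw) s := by
  rw [c.evAt_eq_self hW hw, AlgEquiv.apply_symm_apply]

theorem forall_modelEv {W : Opens M} (hW : (W : Set M) ⊆ c.base.source) {s : X.sec W}
    {P : ExteriorAlgebra ℂ (Fin m → ℂ) → Prop}
    (h : ∀ w (hw : w ∈ W), P (c.evAt w (hW hw) W hw s)) (x : chartImage c.base W hW) :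
    P (modelEv m x (c.iso W hW s)) := by
  obtain ⟨_, w, hw, rfl⟩ := x
  have := h w hw
  rw [c.evAt_eq_self hW hw] at this
  exact this

/-- A section of the model is a finite combination of exterior elements with functions as
coefficients, so it is determined by its exterior-algebra values at all points. -/
theorem eq_of_evAt {W : Opens M} (hW : (W : Set M) ⊆ c.base.source) {s t : X.sec W}
    (h : ∀ w (hw : w ∈ W), c.evAt w (hW hw) W hw s = c.evAt w (hW hw) W hw t) : s = t := by
  refine sub_eq_zero.mp ((c.iso W hW).injective ?_)
  rw [map_zero]
  refine eq_zero_of_modelEv _ (c.forall_modelEv hW (P := fun a => a = 0) fun w hw => ?_)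
  rw [map_sub, h, sub_self]

theorem sgn_evAt {w : M} (hw : w ∈ c.source) {U : Opens M} (hU : w ∈ U) {i : ZMod 2} {s : X.sec U}
    (hs : s ∈ X.parity U i) :
    ExteriorAlgebra.sgn (c.evAt w hw U hU s) = (-1 : ℂ) ^ i.val • c.evAt w hw U hU s := by
  rw [c.evAt_eq (W := U ⊓ c.source) inf_le_left inf_le_right ⟨hU, hw⟩]
  exact sgn_modelEv ((c.iso_parity _ _ _ _).mp (X.map_parity inf_le_left i s hs)) _

/-- The value a of an odd section satisfies sgn a = -a, while the augmentation is invariant under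
sgn; so the augmentation of a is zero. -/
theorem evAt_mem_degGE_one {w : M} (hw : w ∈ c.source) {U : Opens M} (hU : w ∈ U) {s : X.sec U}
    (hs : s ∈ X.oddSpan U) : c.evAt w hw U hU s ∈ ExteriorAlgebra.degGE (Fin m → ℂ) 1 := by
  induction hs using Submodule.span_induction with
  | mem s hs =>
    rw [ExteriorAlgebra.mem_degGE_one_iff, ← ExteriorAlgebra.algebraMapInv_sgn]
    have h := congrArg ExteriorAlgebra.algebraMapInv (c.sgn_evAt hw hU hs)
    have v1 : ((1 : ZMod 2)).val = 1 := rfl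
    rw [map_smul, ExteriorAlgebra.algebraMapInv_sgn, v1, pow_one, neg_one_smul] at h
    rw [ExteriorAlgebra.algebraMapInv_sgn]
    exact self_eq_neg.mp h
  | zero => simp
  | add s t _ _ hs ht => rw [map_add]; exact add_mem hs ht
  | smul a s _ hs =>
    rw [smul_eq_mul, map_mul]
    exact ExteriorAlgebra.mul_mem_degGE_left 1 hs

theorem evAt_mem_degGE_of_mem_oddSpan {w : M} (hw : w ∈ c.source) {U : Opens M} (hU : w ∈ U)
    (k : ℕ) {s : X.sec U} (hs : s ∈ X.oddSpan U ^ k) :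
    c.evAt w hw U hU s ∈ ExteriorAlgebra.degGE (Fin m → ℂ) k := by
  induction k generalizing s with
  | zero => rw [ExteriorAlgebra.degGE_zero]; trivial
  | succ k ih =>
    rw [Submodule.pow_succ] at hs
    induction hs using Submodule.mul_induction_on' with
    | mem_mul_mem a ha b hb =>
      rw [map_mul, ← ExteriorAlgebra.degGE_mul]
      exact Submodule.mul_mem_mul (ih ha) (c.evAt_mem_degGE_one hw hU hb)
    | add a _ b _ ha hb => rw [map_add]; exact add_mem ha hb

theorem evAt_mem_degGE {w : M} (hw : w ∈ c.source) {U : Opens M} (hU : w ∈ U)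
    (k : ℕ) {s : X.sec U} (hs : s ∈ X.oddPow k U) :
    c.evAt w hw U hU s ∈ ExteriorAlgebra.degGE (Fin m → ℂ) k := by
  obtain ⟨V, hV, hwV, h⟩ := hs w hU
  rw [← c.evAt_res hw hV hwV]
  exact c.evAt_mem_degGE_of_mem_oddSpan hw hwV k h

/-- The odd coordinate `ξ` on an open set in the domain of a chart that corresponds to a vector. -/
noncomputable def xi {W : Opens M} (hW : (W : Set M) ⊆ c.base.source) (v : Fin m → ℂ) : X.sec W :=
  (c.iso W hW).symm (1 ⊗ₜ ExteriorAlgebra.ι ℂ v)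

theorem xi_mem_parity {W : Opens M} (hW : (W : Set M) ⊆ c.base.source) (v : Fin m → ℂ) :
    c.xi hW v ∈ X.parity W 1 := by
  rw [c.iso_parity W hW, xi, AlgEquiv.apply_symm_apply]
  exact one_tmul_ι_mem_modelParity v

theorem evAt_xi {w : M} {W : Opens M} (hW : (W : Set M) ⊆ c.base.source) (hw : w ∈ W)
    (v : Fin m → ℂ) : c.evAt w (hW hw) W hw (c.xi hW v) = ExteriorAlgebra.ι ℂ v := by
  rw [xi, c.evAt_iso_symm, modelEv_tmul]
  exact one_smul ℂ _

theorem iso_symm_one_tmul_mem_oddSpan_pow {W : Opens M} (hW : (W : Set M) ⊆ c.base.source) (k : ℕ)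
    {a : ExteriorAlgebra ℂ (Fin m → ℂ)} (ha : a ∈ ⋀[ℂ]^k (Fin m → ℂ)) :
    (c.iso W hW).symm (1 ⊗ₜ a) ∈ X.oddSpan W ^ k := by
  induction k generalizing a with
  | zero => rw [Submodule.pow_zero, Ideal.one_eq_top]; trivial
  | succ k ih =>
    rw [ExteriorAlgebra.exteriorPower_add_eq, ExteriorAlgebra.exteriorPower_one_eq] at ha
    rw [Submodule.pow_succ]
    induction ha using Submodule.mul_induction_on' with
    | mem_mul_mem a ha b hb =>
      obtain ⟨v, rfl⟩ := hb
      have : (1 : holo n (chartImage c.base W hW)) ⊗ₜ[ℂ] (a * ExteriorAlgebra.ι ℂ v) =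
          (1 ⊗ₜ a) * (1 ⊗ₜ ExteriorAlgebra.ι ℂ v) := by
        rw [Algebra.TensorProduct.tmul_mul_tmul, one_mul]
      rw [this, map_mul]
      exact Submodule.mul_mem_mul (ih ha) (Ideal.subset_span (c.xi_mem_parity hW v))
    | add a _ b _ ha hb => rw [TensorProduct.tmul_add, map_add]; exact add_mem ha hb

/-- Pointwise membership gives coefficients in `degGE`, and each such coefficient is a combination
of products with k odd coordinates on the right. Together with `evAt_mem_degGE_of_mem_oddSpan` this
makes powers of the odd ideal a pointwise condition in a chart. -/
theorem mem_oddSpan_pow_of_evAt {W : Opens M} (hW : (W : Set M) ⊆ c.base.source) (k : ℕ)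
    {s : X.sec W} (h : ∀ w (hw : w ∈ W),
      c.evAt w (hW hw) W hw s ∈ ExteriorAlgebra.degGE (Fin m → ℂ) k) : s ∈ X.oddSpan W ^ k := by
  obtain ⟨t, ht⟩ := mem_range_lTensor_of_modelEv (ExteriorAlgebra.degGE (Fin m → ℂ) k)
    (c.iso W hW s) (c.forall_modelEv hW h)
  rw [← (c.iso W hW).symm_apply_apply s, ← ht]
  clear ht h s
  induction t using TensorProduct.induction_on with
  | zero => simp
  | tmul f a =>
    rw [LinearMap.lTensor_tmul]
    obtain ⟨a, ha⟩ := a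
    simp only [Submodule.subtype_apply]
    rw [ExteriorAlgebra.degGE] at ha
    induction ha using Submodule.mul_induction_on' with
    | mem_mul_mem a _ b hb =>
      have : f ⊗ₜ[ℂ] (a * b) = (f ⊗ₜ a) * (1 ⊗ₜ b) := by
        rw [Algebra.TensorProduct.tmul_mul_tmul, mul_one]
      rw [this, map_mul]
      exact Ideal.mul_mem_left _ _ (c.iso_symm_one_tmul_mem_oddSpan_pow hW k hb)
    | add a _ b _ ha hb => rw [TensorProduct.tmul_add, map_add]; exact add_mem ha hb
  | add s t hs ht => rw [map_add, map_add]; exact add_mem hs ht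

/-- The complex value of a section at a point of a chart. -/
noncomputable def val (w : M) (hw : w ∈ c.source) (U : Opens M) (hU : w ∈ U) : X.sec U →ₐ[ℂ] ℂ :=
  ExteriorAlgebra.algebraMapInv.comp (c.evAt w hw U hU)

theorem val_res {w : M} (hw : w ∈ c.source) {U V : Opens M} (hVU : V ≤ U) (hV : w ∈ V)
    (s : X.sec U) : c.val w hw V hV (X.res hVU s) = c.val w hw U (hVU hV) s := by
  simp [val, c.evAt_res hw hVU hV]

theorem val_eq_zero_of_mem_oddIdeal {w : M} (hw : w ∈ c.source) {U : Opens M} (hU : w ∈ U)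
    {s : X.sec U} (hs : s ∈ X.oddIdeal U) : c.val w hw U hU s = 0 :=
  ExteriorAlgebra.algebraMapInv_of_mem_degGE_one (c.evAt_mem_degGE hw hU 1 hs)

/-- A section is invertible near the points where its value is not zero. -/
theorem exists_isUnit_of_val_ne_zero {w : M} (hw : w ∈ c.source) {U : Opens M} (hU : w ∈ U)
    {f : X.sec U} (hf : c.val w hw U hU f ≠ 0) :
    ∃ (V : Opens M) (h : V ≤ U), w ∈ V ∧ IsUnit (X.res h f) := by
  set W := U ⊓ c.source
  have hW : (W : Set M) ⊆ c.base.source := inf_le_right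
  have hwW : w ∈ W := ⟨hU, hw⟩
  obtain ⟨g, hg, hgf⟩ := (modelBody n m _ (c.iso W hW (X.res inf_le_left f))).2
  have hval : ∀ w' (hw' : w' ∈ W), g (c.base w') = c.val w' hw'.2 U hw'.1 f := by
    intro w' hw'
    have h1 := hgf (c.pt hW w' hw')
    rw [modelBody_apply, ← c.evAt_eq inf_le_left hW hw'] at h1
    exact h1.symm
  -- The unit is found on the open set where the underlying holomorphic function is nonzero.
  have hopen : IsOpen ((W : Set M) ∩ (fun w' => g (c.base w')) ⁻¹' {0}ᶜ) := by
    refine ContinuousOn.isOpen_inter_preimage ?_ W.2 isOpen_compl_singleton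
    exact hg.continuousOn.comp (c.base.continuousOn.mono hW) (fun x hx => Set.mem_image_of_mem _ hx)
  let V : Opens M := ⟨_, hopen⟩
  have hVW : V ≤ W := fun x hx => hx.1
  refine ⟨V, hVW.trans inf_le_left, ⟨hwW, ?_⟩, ?_⟩
  · change g (c.base w) ≠ 0
    rw [hval w hwW]
    exact hf
  · rw [← MulEquiv.isUnit_map (c.iso V (Set.Subset.trans hVW hW))]
    refine isUnit_of_modelBody_ne_zero _ (c.forall_modelEv _
      (P := fun a => ExteriorAlgebra.algebraMapInv a ≠ 0) fun w' hw' => ?_)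
    rw [c.evAt_res (hVW hw').2]
    have h1 : g (c.base w') ≠ 0 := hw'.2
    rwa [hval w' (hVW hw')] at h1

/-- Non-invertibility of the germ of f - a means exactly that its complex value vanishes. The left
side mentions no chart, so complex values are independent of the chart. -/
theorem hasValue_iff {w : M} (hw : w ∈ c.source) {U : Opens M} (hU : w ∈ U) {f : X.sec U} {a : ℂ} :
    X.HasValue f w a ↔ c.val w hw U hU f = a := by
  constructor
  · intro h
    by_contra hne
    have h1 : c.val w hw U hU (f - algebraMap ℂ _ a) ≠ 0 := by
      rw [map_sub, AlgHom.commutes]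
      exact sub_ne_zero.mpr hne
    obtain ⟨V, hV, hwV, hu⟩ := c.exists_isUnit_of_val_ne_zero hw hU h1
    rw [map_sub, AlgHom.commutes] at hu
    exact h V hV hwV hu
  · rintro h V hV hwV hu
    have := hu.map (c.val w hw V hwV)
    rw [map_sub, c.val_res, h, AlgHom.commutes] at this
    simp at this

end SuperChart
/-! ### Vector fields and the powers of the odd ideal -/

namespace SuperSpace

variable {M : Type u} [TopologicalSpace M] (X : SuperSpace M)

theorem oddSpan_pow_le_oddPow (k : ℕ) (U : Opens M) : X.oddSpan U ^ k ≤ X.oddPow k U :=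
  fun s hs w hw => ⟨U, le_rfl, hw, by rwa [X.res_self]⟩

theorem oddSpan_mul_mem_right {U : Opens M} {s : X.sec U} (hs : s ∈ X.oddSpan U) (t : X.sec U) :
    s * t ∈ X.oddSpan U := by
  induction hs using Submodule.span_induction with
  | mem x hx =>
    rw [← X.sum_proj U t, Finset.mul_sum]
    refine Submodule.sum_mem _ fun i _ => ?_
    rw [X.supercomm U 1 i x _ hx (X.proj_mem U i t), ← smul_mul_assoc]
    exact Ideal.mul_mem_left _ _ (Ideal.subset_span hx)
  | zero => simp
  | add x y _ _ hx hy => rw [add_mul]; exact add_mem hx hy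
  | smul c x _ hx => rw [smul_eq_mul, mul_assoc]; exact Ideal.mul_mem_left _ _ hx

theorem oddSpan_pow_mul_mem_right {U : Opens M} (k : ℕ) {s : X.sec U} (hs : s ∈ X.oddSpan U ^ k)
    (t : X.sec U) : s * t ∈ X.oddSpan U ^ k := by
  cases k with
  | zero => rw [Submodule.pow_zero, Ideal.one_eq_top]; trivial
  | succ k =>
    rw [Submodule.pow_succ] at hs ⊢
    induction hs using Submodule.mul_induction_on' with
    | mem_mul_mem a ha b hb =>
      rw [mul_assoc]
      exact Submodule.mul_mem_mul ha (X.oddSpan_mul_mem_right hb t)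
    | add a _ b _ ha hb => rw [add_mul]; exact add_mem ha hb

theorem oddSpan_pow_succ_le (k : ℕ) (U : Opens M) : X.oddSpan U ^ (k + 1) ≤ X.oddSpan U ^ k := by
  intro s hs
  rw [Submodule.pow_succ] at hs
  induction hs using Submodule.mul_induction_on' with
  | mem_mul_mem a ha b hb => exact X.oddSpan_pow_mul_mem_right k ha b
  | add a _ b _ ha hb => exact add_mem ha hb

theorem oddPow_succ_le (k : ℕ) (U : Opens M) : X.oddPow (k + 1) U ≤ X.oddPow k U := by
  intro s hs w hw
  obtain ⟨V, h, hwV, hV⟩ := hs w hw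
  exact ⟨V, h, hwV, X.oddSpan_pow_succ_le k V hV⟩

theorem mem_oddPow_of_locally {k : ℕ} {U : Opens M} {s : X.sec U}
    (h : ∀ w ∈ U, ∃ (V : Opens M) (hV : V ≤ U), w ∈ V ∧ X.res hV s ∈ X.oddPow k V) :
    s ∈ X.oddPow k U := by
  intro w hw
  obtain ⟨V, hV, hwV, hs⟩ := h w hw
  obtain ⟨W, hW, hwW, hs'⟩ := hs w hwV
  exact ⟨W, hW.trans hV, hwW, by rwa [X.res_res] at hs'⟩

/-- By the Leibniz rule a superderivation destroys at most one of the k + 1 factors. The left factor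
is split into parities because the rule has a sign depending on it. -/
theorem superDer_oddSpan_pow {a : ZMod 2} {δ : X.PreEnd} (hδ : δ ∈ X.superDer a) (U : Opens M)
    (k : ℕ) {s : X.sec U} (hs : s ∈ X.oddSpan U ^ (k + 1)) : δ U s ∈ X.oddSpan U ^ k := by
  induction k generalizing s with
  | zero => rw [Submodule.pow_zero, Ideal.one_eq_top]; trivial
  | succ k ih =>
    rw [Submodule.pow_succ] at hs
    induction hs using Submodule.mul_induction_on' with
    | mem_mul_mem b hb c hc =>
      rw [← X.sum_proj U b, Finset.sum_mul, map_sum]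
      refine Submodule.sum_mem _ fun i _ => ?_
      have hbi := X.proj_oddSpan_pow U (k + 1) i b hb
      rw [hδ.2.2 U i _ c (X.proj_mem U i b)]
      refine add_mem ?_ (Submodule.smul_of_tower_mem _ _ (X.oddSpan_pow_mul_mem_right _ hbi _))
      rw [Submodule.pow_succ]
      exact Submodule.mul_mem_mul (ih hbi) hc
    | add b _ c _ hb hc => rw [map_add]; exact add_mem hb hc

/-- Superderivations map `𝓘 ^ (k + 1)` into `𝓘 ^ k`. -/
theorem superDer_oddPow {a : ZMod 2} {δ : X.PreEnd} (hδ : δ ∈ X.superDer a) (U : Opens M)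
    (k : ℕ) {s : X.sec U} (hs : s ∈ X.oddPow (k + 1) U) : δ U s ∈ X.oddPow k U := by
  intro w hw
  obtain ⟨V, h, hwV, hV⟩ := hs w hw
  exact ⟨V, h, hwV, by rw [hδ.1 U V h]; exact X.superDer_oddSpan_pow hδ V k hV⟩

/-- Even superderivations preserve the odd ideal. -/
theorem superDer_zero_oddIdeal {δ : X.PreEnd} (hδ : δ ∈ X.superDer 0) (U : Opens M)
    {s : X.sec U} (hs : s ∈ X.oddIdeal U) : δ U s ∈ X.oddIdeal U := by
  intro w hw
  obtain ⟨V, h, hwV, hV⟩ := hs w hw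
  refine ⟨V, h, hwV, ?_⟩
  rw [hδ.1 U V h]
  rw [Submodule.pow_one] at hV ⊢
  generalize X.res h s = t at hV
  induction hV using Submodule.span_induction with
  | mem x hx => exact Ideal.subset_span (by simpa using hδ.2.1 V 1 x hx)
  | zero => simp
  | add x y _ _ hx hy => rw [map_add]; exact add_mem hx hy
  | smul c x hx0 hx =>
    rw [smul_eq_mul, ← X.sum_proj V c, Finset.sum_mul, map_sum]
    refine Submodule.sum_mem _ fun i _ => ?_
    rw [hδ.2.2 V i _ x (X.proj_mem V i c)]
    exact add_mem (Ideal.mul_mem_left _ _ hx0)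
      (Submodule.smul_of_tower_mem _ _ (Ideal.mul_mem_left _ _ hx))

theorem sum_zmod_two {A : Type*} [AddCommMonoid A] (f : ZMod 2 → A) : ∑ a, f a = f 0 + f 1 :=
  Fin.sum_univ_two f

theorem part_add_part (T : X.PreEnd) : X.part 0 T + X.part 1 T = T := by
  rw [← sum_zmod_two (fun a => X.part a T)]
  funext U
  ext s
  have h : ∀ a, X.part a T U s = ∑ b : ZMod 2, X.proj U (a + b) (T U (X.proj U b s)) := by
    simp [part]
  rw [Finset.sum_apply, LinearMap.sum_apply]
  simp only [h]
  rw [Finset.sum_comm]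
  have h2 : ∀ (b : ZMod 2) (z : X.sec U), ∑ a : ZMod 2, X.proj U (a + b) z = z := by
    intro b z
    rw [← Equiv.sum_comp (Equiv.subRight b)]
    simpa using X.sum_proj U z
  simp only [h2]
  rw [← map_sum, X.sum_proj]

/-- The difference of the even and the odd component. -/
def twist (T : X.PreEnd) : X.PreEnd := X.part 0 T - X.part 1 T

/-- As the twist is an involution on vector fields and respects the inclusions between the 𝓘^k,
inclusions proved for the twist of x hold for x. -/
theorem twist_twist {x : X.PreEnd} (hx : x ∈ X.vectorFields) : X.twist (X.twist x) = x := by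
  have h0 := X.part_mem_superDer hx 0
  have h1 := X.part_mem_superDer hx 1
  conv_rhs => rw [← X.part_add_part x]
  simp only [twist, map_sub, X.part_of_superDer h0, X.part_of_superDer h1]
  simp

theorem twist_oddPow (T : X.PreEnd) (U : Opens M) (k l : ℕ)
    (hT : ∀ s ∈ X.oddPow k U, T U s ∈ X.oddPow l U) :
    ∀ s ∈ X.oddPow k U, X.twist T U s ∈ X.oddPow l U := fun s hs =>
  sub_mem (X.part_oddPow T U k l hT 0 s hs) (X.part_oddPow T U k l hT 1 s hs)

/-- Against an odd y the sign rule affects only the odd part of x, so the twist absorbs it and x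
need not be homogeneous. -/
theorem superBracket_odd (x : X.PreEnd) {y : X.PreEnd} (hy : y ∈ X.superDer 1) (U : Opens M)
    (s : X.sec U) : X.superBracket x y U s = x U (y U s) - y U (X.twist x U s) := by
  have v0 : ((0 : ZMod 2)).val = 0 := rfl
  have v1 : ((1 : ZMod 2)).val = 1 := rfl
  have h : ∀ z, x U z = X.part 0 x U z + X.part 1 x U z := fun z => by
    conv_lhs => rw [← X.part_add_part x]
    rfl
  rw [superBracket_apply, sum_zmod_two, sum_zmod_two, sum_zmod_two, X.part_of_superDer hy,
    X.part_of_superDer hy, h]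
  simp [v0, v1, twist]
  abel

theorem mem_filtration_natCast {k : ℕ} {x : X.vectorFields} :
    x ∈ X.filtration k ↔ ∀ U : Opens M, (∀ s ∈ X.oddPow 0 U, x.1 U s ∈ X.oddPow k U) ∧
      ∀ s ∈ X.oddPow 1 U, x.1 U s ∈ X.oddPow (k + 1) U := by
  constructor
  · intro h U
    have := h (Int.natCast_nonneg k) U
    rw [Int.toNat_natCast] at this
    exact ⟨fun s _ => this.1 s, this.2⟩
  · intro h _ U
    rw [Int.toNat_natCast]
    exact ⟨fun s => (h U).1 s (X.oddPow_zero_mem U s), (h U).2⟩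

theorem filtration_succ_le (k : ℕ) : X.filtration ((k + 1 : ℕ) : ℤ) ≤ X.filtration (k : ℤ) := by
  intro x hx
  rw [mem_filtration_natCast] at hx ⊢
  exact fun U => ⟨fun s hs => X.oddPow_succ_le _ _ ((hx U).1 s hs),
    fun s hs => X.oddPow_succ_le _ _ ((hx U).2 s hs)⟩

/-- A family of endomorphisms that preserves the required inclusions on both sides gives a bracket
with the corresponding inclusions. -/
theorem superBracket_mem_oddPow (x y : X.PreEnd) (U : Opens M) (k : ℕ) (s : X.sec U)
    (h : ∀ a b : ZMod 2, X.part a x U (X.part b y U s) ∈ X.oddPow k U)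
    (h' : ∀ a b : ZMod 2, X.part b y U (X.part a x U s) ∈ X.oddPow k U) :
    X.superBracket x y U s ∈ X.oddPow k U := by
  rw [superBracket_apply]
  simp only [Finset.sum_apply, LinearMap.sum_apply]
  exact Submodule.sum_mem _ fun a _ => Submodule.sum_mem _ fun b _ =>
    sub_mem (h a b) (Submodule.smul_of_tower_mem _ _ (h' a b))

/-- This is the easy inclusion in transitivity: a bracket with any vector field costs at most one
power of 𝓘. -/
theorem bracket_mem_filtration {k : ℕ} {x : X.vectorFields}
    (hx : x ∈ X.filtration ((k + 1 : ℕ) : ℤ)) (y : X.vectorFields) :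
    X.bracket x y ∈ X.filtration (k : ℤ) := by
  rw [mem_filtration_natCast] at hx ⊢
  intro U
  have h0 := X.part_oddPow x.1 U _ _ (hx U).1
  have h1 := X.part_oddPow x.1 U _ _ (hx U).2
  constructor
  · intro s hs
    refine X.superBracket_mem_oddPow x.1 y.1 U k s
      (fun a b => X.oddPow_succ_le _ _ (h0 a _ (X.oddPow_zero_mem U _))) (fun a b => ?_)
    exact X.superDer_oddPow (X.part_mem_superDer y.2 b) U k (h0 a s hs)
  · intro s hs
    refine X.superBracket_mem_oddPow x.1 y.1 U (k + 1) s
      (fun a b => h0 a _ (X.oddPow_zero_mem U _)) (fun a b => ?_)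
    exact X.superDer_oddPow (X.part_mem_superDer y.2 b) U (k + 1) (h1 a s hs)

end SuperSpace

/-! ### Odd vector fields as contractions at a point, in leading order -/

namespace SuperChart

variable {M : Type u} [TopologicalSpace M] {X : SuperSpace M} {n m : ℕ} (c : SuperChart X n m)

/-- The odd tangent vector with given components in a chart. -/
noncomputable def tangent (w : M) (hw : w ∈ c.source) (φ : Module.Dual ℂ (Fin m → ℂ)) :
    X.OddTangent w where
  toFun U hU :=
    { toFun := fun s =>
        ExteriorAlgebra.algebraMapInv (ExteriorAlgebra.contr φ (c.evAt w hw U hU s))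
      map_add' := fun s t => by simp
      map_smul' := fun a s => by
        change ExteriorAlgebra.algebraMapInv
          (ExteriorAlgebra.contr φ (c.evAt w hw U hU (a • (s : X.sec U)))) = _
        simp }
  map_res U V h hV s := by
    change ExteriorAlgebra.algebraMapInv (ExteriorAlgebra.contr φ (c.evAt w hw V hV _)) = _
    rw [c.evAt_res hw h hV]
    rfl
  map_smul_of_vanish U hU f s hf := by
    change ExteriorAlgebra.algebraMapInv
      (ExteriorAlgebra.contr φ (c.evAt w hw U hU (f * (s : X.sec U)))) = 0
    have hf' : ExteriorAlgebra.algebraMapInv (c.evAt w hw U hU f) = 0 :=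
      (c.hasValue_iff hw hU).mp hf
    -- In the augmented Leibniz rule one term contains the value of s, zero because s is in 𝓘, and
    -- the other the value of f, zero by assumption.
    rw [map_mul, ExteriorAlgebra.contr_mul, map_add, map_mul, map_mul,
      ExteriorAlgebra.algebraMapInv_sgn, hf',
      ExteriorAlgebra.algebraMapInv_of_mem_degGE_one (c.evAt_mem_degGE hw hU 1 s.2)]
    simp

theorem tangent_apply (w : M) (hw : w ∈ c.source) (φ : Module.Dual ℂ (Fin m → ℂ)) (U : Opens M)
    (hU : w ∈ U) (s : X.oddIdeal U) : (c.tangent w hw φ).toFun U hU s =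
      ExteriorAlgebra.algebraMapInv (ExteriorAlgebra.contr φ (c.evAt w hw U hU s)) := rfl

/-- In the lowest degree, an odd superderivation acts at a point by contraction with its value. -/
theorem evAt_sub_contr_mem {w : M} (hw : w ∈ c.source) {U : Opens M} (hU : w ∈ U)
    {y : X.PreEnd} (hy : y ∈ X.superDer 1) (φ : Module.Dual ℂ (Fin m → ℂ))
    (hφ : ∀ s : X.oddIdeal U, c.val w hw U hU (y U s) = (c.tangent w hw φ).toFun U hU s)
    (k : ℕ) {t : X.sec U} (ht : t ∈ X.oddSpan U ^ k) :
    c.evAt w hw U hU (y U t) - ExteriorAlgebra.contr φ (c.evAt w hw U hU t) ∈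
      ExteriorAlgebra.degGE (Fin m → ℂ) k := by
  induction k generalizing t with
  | zero => rw [ExteriorAlgebra.degGE_zero]; trivial
  | succ k ih =>
    -- The difference D of the two sides is an odd derivation along the evaluation. It maps the odd
    -- ideal into the augmentation ideal by `hφ`, so D loses no degree, although y and the
    -- contraction each lose one.
    have key : ∀ (i : ZMod 2) (a b : X.sec U), a ∈ X.parity U i →
        c.evAt w hw U hU (y U (a * b)) - ExteriorAlgebra.contr φ (c.evAt w hw U hU (a * b)) =
        (c.evAt w hw U hU (y U a) - ExteriorAlgebra.contr φ (c.evAt w hw U hU a)) *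
          c.evAt w hw U hU b + (-1 : ℂ) ^ i.val • (c.evAt w hw U hU a *
          (c.evAt w hw U hU (y U b) - ExteriorAlgebra.contr φ (c.evAt w hw U hU b))) := by
      intro i a b ha
      have v1 : ((1 : ZMod 2)).val = 1 := rfl
      rw [hy.2.2 U i a b ha, map_mul, ExteriorAlgebra.contr_mul, c.sgn_evAt hw hU ha, v1, one_mul]
      simp only [map_add, map_smul, map_mul, mul_sub, sub_mul, smul_sub, smul_mul_assoc]
      abel
    rw [Submodule.pow_succ] at ht
    induction ht using Submodule.mul_induction_on' with
    | mem_mul_mem a ha b hb =>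
      have hab : a * b = ∑ i, X.proj U i a * b := by rw [← Finset.sum_mul, X.sum_proj]
      rw [hab]
      simp only [map_sum]
      rw [← Finset.sum_sub_distrib]
      refine Submodule.sum_mem _ fun i _ => ?_
      have hai := X.proj_oddSpan_pow U k i a ha
      have hbI : b ∈ X.oddIdeal U :=
        X.oddSpan_pow_le_oddPow 1 U (by rwa [Submodule.pow_one])
      rw [key i _ _ (X.proj_mem U i a), ← ExteriorAlgebra.degGE_mul]
      refine add_mem (Submodule.mul_mem_mul (ih hai) (c.evAt_mem_degGE_one hw hU hb))
        (Submodule.smul_mem _ _ (Submodule.mul_mem_mul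
          (c.evAt_mem_degGE_of_mem_oddSpan hw hU k hai) ?_))
      rw [ExteriorAlgebra.mem_degGE_one_iff, map_sub, sub_eq_zero]
      exact hφ ⟨b, hbI⟩
    | add a _ b _ ha hb =>
      have := add_mem ha hb
      simp only [map_add]
      rwa [← add_sub_add_comm] at this

/-- If the values of a set of odd superderivations exhaust the fibres of the odd tangent bundle, then
a section of `𝓘 ^ k`, `k > 0`, that all of them map into `𝓘 ^ k` belongs to `𝓘 ^ (k + 1)`. -/
theorem mem_oddPow_succ {U : Opens M} (hU : U ≤ c.source) (Y : Set X.PreEnd)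
    (hY : Y ⊆ X.superDer 1)
    (hval : ∀ (w : M) (hw : w ∈ c.source) (φ : Module.Dual ℂ (Fin m → ℂ)), ∃ y ∈ Y,
      ∀ (V : Opens M) (hV : w ∈ V) (s : X.oddIdeal V),
        c.val w hw V hV (y V s) = (c.tangent w hw φ).toFun V hV s)
    {k : ℕ} (hk : k ≠ 0) {t : X.sec U} (ht : t ∈ X.oddPow k U)
    (h : ∀ y ∈ Y, y U t ∈ X.oddPow k U) : t ∈ X.oddPow (k + 1) U := by
  intro w hw
  obtain ⟨V, hV, hwV, htV⟩ := ht w hw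
  refine ⟨V, hV, hwV, c.mem_oddSpan_pow_of_evAt (hV.trans hU) (k + 1) fun w' hw' => ?_⟩
  refine ExteriorAlgebra.mem_degGE_succ_of_contr_mem (Pi.basisFun ℂ (Fin m)) hk
    (c.evAt_mem_degGE_of_mem_oddSpan _ hw' k htV) fun φ => ?_
  obtain ⟨y, hyY, hy⟩ := hval w' (hU (hV hw')) φ
  have h1 := c.evAt_sub_contr_mem (hU (hV hw')) hw' (hY hyY) φ (hy V hw') k htV
  have h2 : c.evAt w' (hU (hV hw')) V hw' (y V (X.res hV t)) ∈
      ExteriorAlgebra.degGE (Fin m → ℂ) k := by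
    rw [← (hY hyY).1 U V hV]
    exact c.evAt_mem_degGE _ hw' k (X.res_oddPow hV k _ (h y hyY))
  have h3 := sub_mem h2 h1
  rwa [sub_sub_cancel] at h3

end SuperChart

/-! ### Transitivity of the filtered superalgebra of vector fields -/

namespace SuperSpace

variable {M : Type u} [TopologicalSpace M] (X : SuperSpace M)

/-- In degree zero the contraction argument says nothing, since contractions kill scalars. Here the
class of x acts by zero on 𝔡_{-1}, and faithfulness applies. -/
theorem mem_filtration_one_of_injective (h : Function.Injective X.grAdjoint) {x : X.vectorFields}
    (hx : x ∈ X.filtration 0) (hxy : ∀ y, X.bracket x y ∈ X.filtration 0) :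
    x ∈ X.filtration 1 := by
  have h0 : X.grAdjoint (Submodule.Quotient.mk ⟨x, hx⟩) = 0 := by
    ext y
    exact (Submodule.Quotient.mk_eq_zero _).mpr (hxy y)
  have h1 := h (h0.trans (map_zero X.grAdjoint).symm)
  exact (Submodule.Quotient.mk_eq_zero ((X.filtration 1).submoduleOf (X.filtration 0))).mp h1

/-- The hard inclusion for positive k: y x' = x y - [x, y] controls the image of x' under every odd
y, and `mem_oddPow_succ` then gains one power of 𝓘. -/
theorem mem_filtration_succ {n m : ℕ} (hX : IsSupermanifold X n m)
    (hspan : ∀ (w : M) (v : X.OddTangent w), ∃ σ ∈ X.inducedSections, σ.val w = v)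
    {k : ℕ} (hk : k ≠ 0) {x : X.vectorFields} (hx : x ∈ X.filtration (k : ℤ))
    (hxy : ∀ y, X.bracket x y ∈ X.filtration (k : ℤ)) :
    x ∈ X.filtration ((k + 1 : ℕ) : ℤ) := by
  let Y : Set X.PreEnd := {y | ∃ γ ∈ X.vectorFields, y = X.part 1 γ}
  have hYd : Y ⊆ X.superDer 1 := by
    rintro _ ⟨γ, hγ, rfl⟩
    exact X.part_mem_superDer hγ 1
  have hval : ∀ (c : SuperChart X n m) (w : M) (hw : w ∈ c.source)
      (φ : Module.Dual ℂ (Fin m → ℂ)), ∃ y ∈ Y, ∀ (V : Opens M) (hV : w ∈ V) (s : X.oddIdeal V),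
        c.val w hw V hV (y V s) = (c.tangent w hw φ).toFun V hV s := by
    intro c w hw φ
    obtain ⟨σ, ⟨γ, hγ, hγσ⟩, hσ⟩ := hspan w (c.tangent w hw φ)
    refine ⟨_, ⟨γ, hγ, rfl⟩, fun V hV s => ?_⟩
    have h1 := (c.hasValue_iff hw hV).mp (hγσ V s w hV)
    rw [hσ, ← X.part_add_part γ] at h1
    rw [← h1]
    change _ = c.val w hw V hV (X.part 0 γ V s + X.part 1 γ V s)
    -- The even part of γ preserves 𝓘 and contributes nothing to values, so passing to odd parts
    -- loses no tangent vectors.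
    rw [map_add, c.val_eq_zero_of_mem_oddIdeal hw hV
      (X.superDer_zero_oddIdeal (X.part_mem_superDer hγ 0) V s.2), zero_add]
  have hmem : ∀ (l : ℕ), l ≠ 0 → ∀ (U : Opens M) (t : X.sec U), t ∈ X.oddPow l U →
      (∀ y ∈ Y, y U t ∈ X.oddPow l U) → t ∈ X.oddPow (l + 1) U := by
    intro l hl U t ht hy
    refine X.mem_oddPow_of_locally fun w hw => ?_
    obtain ⟨c, hc⟩ := hX w
    refine ⟨U ⊓ c.source, inf_le_left, ⟨hw, hc⟩, ?_⟩
    refine c.mem_oddPow_succ inf_le_right Y hYd (hval c) hl (X.res_oddPow _ _ _ ht) fun y hyY => ?_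
    rw [← (hYd hyY).1 U _ inf_le_left]
    exact X.res_oddPow _ _ _ (hy y hyY)
  have hbr : ∀ y ∈ Y, ∀ U : Opens M,
      (∀ s ∈ X.oddPow 0 U, x.1 U (y U s) - y U (X.twist x.1 U s) ∈ X.oddPow k U) ∧
      (∀ s ∈ X.oddPow 1 U, x.1 U (y U s) - y U (X.twist x.1 U s) ∈ X.oddPow (k + 1) U) := by
    intro y hyY U
    have hyv : y ∈ X.vectorFields := Submodule.mem_iSup_of_mem 1 (hYd hyY)
    have h1 := X.mem_filtration_natCast.mp (hxy ⟨y, hyv⟩) U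
    simp only [← X.superBracket_odd x.1 (hYd hyY)]
    exact h1
  rw [mem_filtration_natCast] at hx ⊢
  have h0 : ∀ U, ∀ s ∈ X.oddPow 0 U, x.1 U s ∈ X.oddPow (k + 1) U := by
    intro U
    have h1 : ∀ s ∈ X.oddPow 0 U, X.twist x.1 U s ∈ X.oddPow (k + 1) U := by
      intro s hs
      refine hmem k hk U _ (X.twist_oddPow x.1 U 0 k (hx U).1 s hs) fun y hyY => ?_
      have := sub_mem ((hx U).1 (y U s) (X.oddPow_zero_mem U _)) ((hbr y hyY U).1 s hs)
      rwa [sub_sub_cancel] at this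
    have h2 := X.twist_oddPow _ U _ _ h1
    rwa [X.twist_twist x.2] at h2
  refine fun U => ⟨h0 U, ?_⟩
  -- The section y s need no longer lie in 𝓘, so the improved bound `h0` on arbitrary sections is
  -- needed for x (y s).
  have h1 : ∀ s ∈ X.oddPow 1 U, X.twist x.1 U s ∈ X.oddPow (k + 1 + 1) U := by
    intro s hs
    refine hmem (k + 1) k.succ_ne_zero U _ (X.twist_oddPow x.1 U 1 (k + 1) (hx U).2 s hs)
      fun y hyY => ?_
    have := sub_mem (h0 U (y U s) (X.oddPow_zero_mem U _)) ((hbr y hyY U).2 s hs)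
    rwa [sub_sub_cancel] at this
  have h2 := X.twist_oddPow _ U _ _ h1
  rwa [X.twist_twist x.2] at h2

theorem isTransitiveFiltered {n m : ℕ} (hX : IsSupermanifold X n m)
    (hspan : ∀ (w : M) (v : X.OddTangent w), ∃ σ ∈ X.inducedSections, σ.val w = v)
    (hinj : Function.Injective X.grAdjoint) : IsTransitiveFiltered X.bracket X.filtration := by
  intro p hp
  obtain ⟨k, rfl⟩ := Int.eq_ofNat_of_zero_le hp
  ext x
  constructor
  · intro hx
    exact ⟨X.filtration_succ_le k hx, X.bracket_mem_filtration hx⟩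
  · rintro ⟨hx, hxy⟩
    rcases eq_or_ne k 0 with rfl | hk
    · exact X.mem_filtration_one_of_injective hinj hx hxy
    · exact X.mem_filtration_succ hX hspan hk hx hxy

end SuperSpace
/-! ### Odd tangent vectors in coordinates -/

namespace SuperChart

variable {M : Type u} [TopologicalSpace M] {X : SuperSpace M} {n m : ℕ} (c : SuperChart X n m)

theorem res_xi {U V : Opens M} (hU : (U : Set M) ⊆ c.base.source) (hVU : V ≤ U) (v : Fin m → ℂ) :
    X.res hVU (c.xi hU v) = c.xi (Set.Subset.trans hVU hU) v := by
  refine (c.iso V (Set.Subset.trans hVU hU)).injective ?_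
  rw [c.iso_res U V hU hVU, xi, xi, AlgEquiv.apply_symm_apply, AlgEquiv.apply_symm_apply, modelRes,
    Algebra.TensorProduct.map_tmul, map_one]
  rfl

theorem xi_mem_oddIdeal {U : Opens M} (hU : (U : Set M) ⊆ c.base.source) (v : Fin m → ℂ) :
    c.xi hU v ∈ X.oddIdeal U :=
  X.oddSpan_pow_le_oddPow 1 U
    (by rw [Submodule.pow_one]; exact Ideal.subset_span (c.xi_mem_parity hU v))

/-- The odd coordinates generate the ideal generated by the odd sections. -/
theorem oddSpan_le_span_xi {W : Opens M} (hW : (W : Set M) ⊆ c.base.source) :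
    X.oddSpan W ≤ Ideal.span (Set.range (c.xi hW)) := by
  intro s hs
  obtain ⟨t, ht⟩ := mem_range_lTensor_of_modelEv (ExteriorAlgebra.degGE (Fin m → ℂ) 1)
    (c.iso W hW s) (c.forall_modelEv hW fun w hw => c.evAt_mem_degGE_one _ hw hs)
  rw [← (c.iso W hW).symm_apply_apply s, ← ht]
  clear ht hs s
  induction t using TensorProduct.induction_on with
  | zero => simp
  | tmul f a =>
    rw [LinearMap.lTensor_tmul]
    obtain ⟨a, ha⟩ := a
    simp only [Submodule.subtype_apply]
    rw [ExteriorAlgebra.degGE, ExteriorAlgebra.exteriorPower_one_eq] at ha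
    induction ha using Submodule.mul_induction_on' with
    | mem_mul_mem a _ b hb =>
      obtain ⟨v, rfl⟩ := hb
      have : f ⊗ₜ[ℂ] (a * ExteriorAlgebra.ι ℂ v) = (f ⊗ₜ a) * (1 ⊗ₜ ExteriorAlgebra.ι ℂ v) := by
        rw [Algebra.TensorProduct.tmul_mul_tmul, mul_one]
      rw [this, map_mul]
      exact Ideal.mul_mem_left _ _ (Ideal.subset_span ⟨v, rfl⟩)
    | add a _ b _ ha hb => rw [TensorProduct.tmul_add, map_add]; exact add_mem ha hb
  | add s t hs ht => rw [map_add, map_add]; exact add_mem hs ht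

/-- The components of an odd tangent vector in a chart. -/
noncomputable def coords {w : M} (hw : w ∈ c.source) (v : X.OddTangent w) :
    Module.Dual ℂ (Fin m → ℂ) where
  toFun e := v.toFun c.source hw ⟨c.xi le_rfl e, c.xi_mem_oddIdeal le_rfl e⟩
  map_add' e e' := by
    rw [← map_add]
    congr 1
    ext1
    simp [xi, TensorProduct.tmul_add]
  map_smul' a e := by
    rw [← map_smul]
    congr 1
    ext1
    change c.xi le_rfl (a • e) = a • c.xi le_rfl e
    simp [xi]

theorem coords_apply {w : M} (hw : w ∈ c.source) (v : X.OddTangent w) {U : Opens M}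
    (hU : (U : Set M) ⊆ c.base.source) (hwU : w ∈ U) (e : Fin m → ℂ) :
    c.coords hw v e = v.toFun U hwU ⟨c.xi hU e, c.xi_mem_oddIdeal hU e⟩ := by
  have := v.map_res c.source U hU hwU ⟨c.xi le_rfl e, c.xi_mem_oddIdeal le_rfl e⟩
  rw [coords, LinearMap.coe_mk, AddHom.coe_mk, ← this]
  congr 1
  ext1
  exact c.res_xi (U := c.source) le_rfl hU e

theorem coords_tangent {w : M} (hw : w ∈ c.source) (φ : Module.Dual ℂ (Fin m → ℂ)) :
    c.coords hw (c.tangent w hw φ) = φ := by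
  refine LinearMap.ext fun e => ?_
  rw [c.coords_apply hw _ le_rfl hw, tangent_apply, c.evAt_xi le_rfl hw, ExteriorAlgebra.contr_ι]
  exact ExteriorAlgebra.algebraMap_leftInverse _ _

/-- Subtracting from f its value at `w` leaves a function vanishing there, which the definition of a
tangent vector ignores. Thus tangent vectors are determined on generators of 𝓘. -/
theorem oddTangent_smul {w : M} (hw : w ∈ c.source) (v : X.OddTangent w) (U : Opens M)
    (hU : w ∈ U) (f : X.sec U) (s : X.oddIdeal U) :
    v.toFun U hU (f • s) = c.val w hw U hU f * v.toFun U hU s := by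
  have h := v.map_smul_of_vanish U hU (f - algebraMap ℂ _ (c.val w hw U hU f)) s
    ((c.hasValue_iff hw hU).mpr (by rw [map_sub, AlgHom.commutes]; exact sub_self _))
  have h2 : (f - algebraMap ℂ _ (c.val w hw U hU f)) • s = f • s - (c.val w hw U hU f) • s := by
    rw [sub_smul, algebraMap_smul]
  rw [h2, map_sub, sub_eq_zero] at h
  exact h.trans (map_smul (v.toFun U hU) _ _)

/-- An odd tangent vector is determined by its components in a chart. -/
theorem tangent_coords {w : M} (hw : w ∈ c.source) (v : X.OddTangent w) :
    c.tangent w hw (c.coords hw v) = v := by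
  have key : ∀ (V : Opens M) (hV : V ≤ c.source) (hwV : w ∈ V) (s : X.sec V),
      s ∈ Ideal.span (Set.range (c.xi hV)) → ∃ h : s ∈ X.oddIdeal V,
        (c.tangent w hw (c.coords hw v)).toFun V hwV ⟨s, h⟩ = v.toFun V hwV ⟨s, h⟩ := by
    intro V hV hwV s hs
    induction hs using Submodule.span_induction with
    | mem s hs =>
      obtain ⟨e, rfl⟩ := hs
      refine ⟨c.xi_mem_oddIdeal hV e, ?_⟩
      rw [← c.coords_apply hw v hV hwV, ← c.coords_apply hw _ hV hwV, coords_tangent]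
    | zero => exact ⟨zero_mem _, (map_zero _).trans (map_zero _).symm⟩
    | add s t _ _ hs ht =>
      obtain ⟨hs, hs'⟩ := hs
      obtain ⟨ht, ht'⟩ := ht
      refine ⟨add_mem hs ht, ?_⟩
      have := congrArg₂ (· + ·) hs' ht'
      simp only [← map_add] at this
      exact this
    | smul f s _ hs =>
      obtain ⟨hs, hs'⟩ := hs
      refine ⟨Ideal.mul_mem_left _ _ hs, ?_⟩
      have h1 := c.oddTangent_smul hw (c.tangent w hw (c.coords hw v)) V hwV f ⟨s, hs⟩
      rw [hs', ← c.oddTangent_smul hw v] at h1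
      exact h1
  ext U hU s
  obtain ⟨V, hV, hwV, hs⟩ := s.2 w hU
  rw [Submodule.pow_one] at hs
  have h1 : V ⊓ c.source ≤ U := inf_le_left.trans hV
  have hw1 : w ∈ V ⊓ c.source := ⟨hwV, hw⟩
  have h2 : X.res h1 s ∈ X.oddSpan (V ⊓ c.source) := by
    rw [← X.res_res hV inf_le_left]
    exact X.res_oddSpan _ _ hs
  obtain ⟨_, h3⟩ := key (V ⊓ c.source) inf_le_right hw1 _ (c.oddSpan_le_span_xi inf_le_right h2)
  have h4 := v.map_res U _ h1 hw1 s
  have h5 := (c.tangent w hw (c.coords hw v)).map_res U _ h1 hw1 s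
  exact h5.symm.trans (h3.trans h4)

end SuperChart

/-! ### Contraction with sections of the odd tangent bundle of a split supermanifold -/

section ModelContraction

variable {n m : ℕ} {V : Opens (Fin n → ℂ)}

/-- Contraction of a section of the model superspace with an odd vector field with given
components. -/
noncomputable def modelContr (g : Fin m → holo n V) : ModelSec n m V →ₗ[ℂ] ModelSec n m V :=
  ∑ j, TensorProduct.map (LinearMap.mulLeft ℂ (g j))
    (ExteriorAlgebra.contr ((Pi.basisFun ℂ (Fin m)).coord j))

/-- Contraction is linear over functions, so it commutes with evaluation once the functional is
expanded in the dual basis. -/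
theorem modelEv_modelContr (g : Fin m → holo n V) (x : V) (φ : Module.Dual ℂ (Fin m → ℂ))
    (h : ∀ j, φ (Pi.basisFun ℂ (Fin m) j) = (g j).1 x) (s : ModelSec n m V) :
    modelEv m x (modelContr g s) = ExteriorAlgebra.contr φ (modelEv m x s) := by
  have hφ : φ = ∑ j, (g j).1 x • (Pi.basisFun ℂ (Fin m)).coord j := by
    rw [← (Pi.basisFun ℂ (Fin m)).sum_dual_apply_smul_coord φ]
    simp only [h]
  induction s using TensorProduct.induction_on with
  | zero => simp
  | tmul f a =>
    rw [modelContr, LinearMap.sum_apply, map_sum, modelEv_tmul, hφ,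
      ExteriorAlgebra.contr_sum_left]
    refine Finset.sum_congr rfl fun j _ => ?_
    rw [TensorProduct.map_tmul, modelEv_tmul, ExteriorAlgebra.contr_smul_left, map_smul, smul_smul]
    rfl
  | add s t hs ht => rw [map_add, map_add, map_add, map_add, hs, ht]

end ModelContraction

/-! ### Adapted charts and the lift of odd sections to vector fields of degree -1 -/

namespace SplitStructure

variable {M : Type u} [TopologicalSpace M] {X : SuperSpace M} {n m : ℕ} (S : SplitStructure X n m)

/-- Charts that respect the `ℤ`-gradings. -/
def IsAdapted (c : SuperChart X n m) : Prop :=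
  ∀ (W : Opens M) (h : (W : Set M) ⊆ c.base.source) (q : ℤ) (s : X.sec W),
    s ∈ S.deg W q ↔ c.iso W h s ∈ modelDeg n m _ q

theorem exists_adapted (w : M) : ∃ c : SuperChart X n m, w ∈ c.source ∧ S.IsAdapted c :=
  S.exists_chart w

variable {S}

theorem IsAdapted.evAt_mem {c : SuperChart X n m} (hc : S.IsAdapted c) {w : M} (hw : w ∈ c.source)
    {U : Opens M} (hU : w ∈ U) {q : ℤ} (hq : 0 ≤ q) {s : X.sec U} (hs : s ∈ S.deg U q) :
    c.evAt w hw U hU s ∈ ⋀[ℂ]^q.toNat (Fin m → ℂ) := by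
  rw [c.evAt_eq (W := U ⊓ c.source) inf_le_left inf_le_right ⟨hU, hw⟩]
  exact (mem_modelDeg_iff hq).mp ((hc _ _ q _).mp (S.res_deg inf_le_left q s hs)) _

theorem IsAdapted.mem_deg {c : SuperChart X n m} (hc : S.IsAdapted c) {W : Opens M}
    (hW : (W : Set M) ⊆ c.base.source) {q : ℤ} (hq : 0 ≤ q) {s : X.sec W}
    (hs : ∀ w (hw : w ∈ W), c.evAt w (hW hw) W hw s ∈ ⋀[ℂ]^q.toNat (Fin m → ℂ)) :
    s ∈ S.deg W q := by
  rw [hc W hW, mem_modelDeg_iff hq]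
  exact c.forall_modelEv hW hs

/-- The values of sections in two adapted charts differ by an endomorphism of the exterior
algebra. -/
theorem IsAdapted.exists_transition {c c' : SuperChart X n m} (hc : S.IsAdapted c)
    (hc' : S.IsAdapted c') {w : M} (hw : w ∈ c.source) (hw' : w ∈ c'.source) :
    ∃ θ : ExteriorAlgebra ℂ (Fin m → ℂ) →ₐ[ℂ] ExteriorAlgebra ℂ (Fin m → ℂ),
      (∀ (U : Opens M) (hU : w ∈ U) (s : X.sec U),
        c'.evAt w hw' U hU s = θ (c.evAt w hw U hU s)) ∧
      ∀ v, ∃ v', θ (ExteriorAlgebra.ι ℂ v) = ExteriorAlgebra.ι ℂ v' := by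
  let i : ExteriorAlgebra ℂ (Fin m → ℂ) →ₐ[ℂ] X.sec c.source :=
    (c.iso c.source le_rfl).symm.toAlgHom.comp
      Algebra.TensorProduct.includeRight
  -- The transition at `w` reads, in the second chart, the sections with constant coefficients in
  -- the first one.
  let θ := (c'.evAt w hw' c.source hw).comp i
  have hi : ∀ (U : Opens M) (hU : U ≤ c.source) (a : ExteriorAlgebra ℂ (Fin m → ℂ)),
      X.res hU (i a) = (c.iso U hU).symm (1 ⊗ₜ a) := by
    intro U hU a
    refine (c.iso U hU).injective ?_
    rw [AlgEquiv.apply_symm_apply, c.iso_res c.source U le_rfl hU]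
    change modelRes n m _ (c.iso c.source le_rfl ((c.iso c.source le_rfl).symm (1 ⊗ₜ a))) = _
    rw [AlgEquiv.apply_symm_apply, modelRes, Algebra.TensorProduct.map_tmul, map_one]
    rfl
  have hloc : ∀ (U : Opens M) (hU : U ≤ c.source) (hwU : w ∈ U) (s : ModelSec n m _),
      c'.evAt w hw' U hwU ((c.iso U hU).symm s) =
        θ (c.evAt w hw U hwU ((c.iso U hU).symm s)) := by
    intro U hU hwU s
    induction s using TensorProduct.induction_on with
    | zero => simp
    | tmul f a =>
      have h1 : f ⊗ₜ[ℂ] a = (f ⊗ₜ 1) * (1 ⊗ₜ a) := by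
        rw [Algebra.TensorProduct.tmul_mul_tmul, mul_one, one_mul]
      have h2 : (c.iso U hU).symm (f ⊗ₜ 1) ∈ S.deg U 0 := by
        rw [hc U hU, AlgEquiv.apply_symm_apply, mem_modelDeg_iff le_rfl]
        intro x
        rw [modelEv_tmul]
        refine Submodule.smul_mem _ _ ?_
        rw [Int.toNat_zero, ExteriorAlgebra.exteriorPower_zero_eq]
        exact Submodule.mem_one.mpr ⟨1, map_one _⟩
      -- A section of degree zero has a scalar value in every adapted chart; by `hasValue_iff` this
      -- scalar is the same in both charts. For charts that ignore the grading, the value could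
      -- acquire nilpotent terms.
      have h3 : ∀ (c₁ : SuperChart X n m) (_ : S.IsAdapted c₁) (hw₁ : w ∈ c₁.source),
          c₁.evAt w hw₁ U hwU ((c.iso U hU).symm (f ⊗ₜ 1)) =
            algebraMap ℂ _ (c₁.val w hw₁ U hwU ((c.iso U hU).symm (f ⊗ₜ 1))) := by
        intro c₁ hc₁ hw₁
        have h4 := hc₁.evAt_mem hw₁ hwU le_rfl h2
        rw [Int.toNat_zero, ExteriorAlgebra.exteriorPower_zero_eq] at h4
        obtain ⟨r, hr⟩ := Submodule.mem_one.mp h4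
        change _ = algebraMap ℂ _ (ExteriorAlgebra.algebraMapInv (c₁.evAt w hw₁ U hwU _))
        rw [← hr, ExteriorAlgebra.algebraMap_leftInverse]
      have h5 : c'.val w hw' U hwU ((c.iso U hU).symm (f ⊗ₜ 1)) =
          c.val w hw U hwU ((c.iso U hU).symm (f ⊗ₜ 1)) :=
        (c'.hasValue_iff hw' hwU).mp ((c.hasValue_iff hw hwU).mpr rfl)
      have h6 : c.evAt w hw U hwU ((c.iso U hU).symm (1 ⊗ₜ a)) = a := by
        rw [c.evAt_iso_symm hU hwU, modelEv_tmul]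
        exact one_smul ℂ _
      rw [h1, map_mul, map_mul, map_mul, map_mul, h6, h3 c' hc', h3 c hc, h5, AlgHom.commutes,
        ← hi U hU, c'.evAt_res]
      rfl
    | add s t hs ht => simp only [map_add, hs, ht]
  refine ⟨θ, fun U hU s => ?_, fun v => ?_⟩
  · have hwU : w ∈ U ⊓ c.source := ⟨hU, hw⟩
    have := hloc (U ⊓ c.source) inf_le_right hwU
      (c.iso (U ⊓ c.source) inf_le_right (X.res inf_le_left s))
    rwa [AlgEquiv.symm_apply_apply, c'.evAt_res, c.evAt_res] at this
  · have h1 : i (ExteriorAlgebra.ι ℂ v) ∈ S.deg c.source 1 := by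
      rw [hc _ le_rfl]
      change c.iso c.source le_rfl
        ((c.iso c.source le_rfl).symm (1 ⊗ₜ ExteriorAlgebra.ι ℂ v)) ∈ _
      rw [AlgEquiv.apply_symm_apply, mem_modelDeg_iff zero_le_one]
      intro x
      rw [modelEv_tmul]
      exact Submodule.smul_mem _ _ (ExteriorAlgebra.ι_mem_exteriorPower_one v)
    have h2 := hc'.evAt_mem hw' hw zero_le_one h1
    rw [Int.toNat_one, ExteriorAlgebra.exteriorPower_one_eq] at h2
    obtain ⟨v', hv'⟩ := h2
    exact ⟨v', hv'.symm⟩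

/-- Contraction with an odd tangent vector does not depend on the adapted chart. -/
theorem IsAdapted.contr_transfer {c c' : SuperChart X n m} (hc : S.IsAdapted c)
    (hc' : S.IsAdapted c') {w : M} (hw : w ∈ c.source) (hw' : w ∈ c'.source) (v : X.OddTangent w)
    {U : Opens M} (hU : w ∈ U) {s t : X.sec U}
    (h : c.evAt w hw U hU t = ExteriorAlgebra.contr (c.coords hw v) (c.evAt w hw U hU s)) :
    c'.evAt w hw' U hU t = ExteriorAlgebra.contr (c'.coords hw' v) (c'.evAt w hw' U hU s) := by
  obtain ⟨θ, hθ, hι⟩ := hc.exists_transition hc' hw hw'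
  rw [hθ, hθ, h]
  refine ExteriorAlgebra.contr_algHom θ _ _ (fun e => ?_) _
  obtain ⟨e', he'⟩ := hι e
  refine ⟨e', he', ?_⟩
  -- Both coordinate functionals arise from the pairing of v with the same odd coordinate, computed
  -- in the two charts.
  have h1 := c'.tangent_apply w hw' (c'.coords hw' v) c.source hw
    ⟨c.xi le_rfl e, c.xi_mem_oddIdeal le_rfl e⟩
  rw [c'.tangent_coords, ← c.coords_apply hw v le_rfl hw, hθ, c.evAt_xi le_rfl hw, he',
    ExteriorAlgebra.contr_ι, ExteriorAlgebra.algebraMap_leftInverse] at h1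
  exact h1.symm

variable (S)

/-- The section `t` is the contraction of `s` with a section of the odd tangent bundle. -/
def IsContr (σ : X.OddSection) {U : Opens M} (s t : X.sec U) : Prop :=
  ∀ (c : SuperChart X n m) (_ : S.IsAdapted c) (w : M) (hw : w ∈ c.source) (hU : w ∈ U),
    c.evAt w hw U hU t = ExteriorAlgebra.contr (c.coords hw (σ.val w)) (c.evAt w hw U hU s)

variable {S} {σ : X.OddSection}

theorem IsContr.res {U V : Opens M} (hV : V ≤ U) {s t : X.sec U} (h : S.IsContr σ s t) :
    S.IsContr σ (X.res hV s) (X.res hV t) := by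
  intro c hc w hw hwV
  rw [c.evAt_res, c.evAt_res]
  exact h c hc w hw _

theorem IsContr.of_locally {U : Opens M} {s t : X.sec U}
    (h : ∀ w ∈ U, ∃ (V : Opens M) (hV : V ≤ U), w ∈ V ∧ S.IsContr σ (X.res hV s) (X.res hV t)) :
    S.IsContr σ s t := by
  intro c hc w hw hU
  obtain ⟨V, hV, hwV, hst⟩ := h w hU
  have := hst c hc w hw hwV
  rwa [c.evAt_res, c.evAt_res] at this

/-- Contractions are prescribed at all points in all adapted charts. This uniqueness yields gluing,
linearity and the Leibniz rule for `contrField`. -/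
theorem IsContr.unique {U : Opens M} {s t t' : X.sec U} (h : S.IsContr σ s t)
    (h' : S.IsContr σ s t') : t = t' := by
  refine X.eq_of_locally_eq fun w hw => ?_
  obtain ⟨c, hwc, hc⟩ := S.exists_adapted w
  refine ⟨U ⊓ c.source, inf_le_left, ⟨hw, hwc⟩, ?_⟩
  refine c.eq_of_evAt inf_le_right fun w' hw' => ?_
  rw [c.evAt_res hw'.2 inf_le_left hw', c.evAt_res hw'.2 inf_le_left hw', h c hc, h' c hc]

theorem exists_isContr_locally (σ : X.OddSection) {U : Opens M} (s : X.sec U) (w : M) (hw : w ∈ U) :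
    ∃ (V : Opens M) (hV : V ≤ U), w ∈ V ∧ ∃ t : X.sec V, S.IsContr σ (X.res hV s) t := by
  obtain ⟨c, hwc, hc⟩ := S.exists_adapted w
  choose V hV hwV g hg using fun j => σ.holomorphic c.source
    ⟨c.xi le_rfl (Pi.basisFun ℂ (Fin m) j), c.xi_mem_oddIdeal le_rfl _⟩ w hwc
  let W : Opens M := ⟨(⋂ j, (V j : Set M)) ∩ (U ⊓ c.source : Opens M),
    (isOpen_iInter_of_finite fun j => (V j).2).inter (U ⊓ c.source).2⟩
  have hWU : W ≤ U := fun x hx => hx.2.1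
  have hWc : W ≤ c.source := fun x hx => hx.2.2
  have hWV : ∀ j, W ≤ V j := fun j x hx => Set.mem_iInter.mp hx.1 j
  -- Holomorphy of σ prescribes only the values of each g_j; nilpotent terms of g_j are irrelevant,
  -- so its underlying function serves as the component.
  let G : Fin m → holo n (chartImage c.base W hWc) :=
    fun j => modelBody n m _ (c.iso W hWc (X.res (hWV j) (g j)))
  refine ⟨W, hWU, ⟨Set.mem_iInter.mpr hwV, hw, hwc⟩,
    (c.iso W hWc).symm (modelContr G (c.iso W hWc (X.res hWU s))), ?_⟩
  intro c' hc' w' hw' hwW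
  refine hc.contr_transfer hc' (hWc hwW) hw' (σ.val w') hwW ?_
  rw [c.evAt_iso_symm hWc hwW, c.evAt_eq_self hWc hwW]
  refine modelEv_modelContr G _ _ (fun j => ?_) _
  have h1 := (c.hasValue_iff (hWc hwW) (hWV j hwW)).mp (hg j w' (hWV j hwW))
  change _ = (modelBody n m _ (c.iso W hWc (X.res (hWV j) (g j)))).1 _
  rw [modelBody_apply, ← c.evAt_eq_self hWc hwW, c.evAt_res]
  exact h1.symm

variable (S)

theorem exists_isContr (σ : X.OddSection) {U : Opens M} (s : X.sec U) :
    ∃ t : X.sec U, S.IsContr σ s t := by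
  choose V hV hw t ht using fun w : U => exists_isContr_locally (S := S) σ s w.1 w.2
  obtain ⟨r, hr⟩ := X.exists_gluing V hV hw t fun w w' => by
    refine IsContr.unique (S := S) (σ := σ) (s := X.res (inf_le_left.trans (hV w)) s) ?_ ?_
    · rw [← X.res_res (hV w)]
      exact (ht w).res _
    · rw [← X.res_res (hV w') inf_le_right]
      exact (ht w').res _
  exact ⟨r, IsContr.of_locally fun w hwU =>
    ⟨V ⟨w, hwU⟩, hV _, hw ⟨w, hwU⟩, by rw [hr]; exact ht _⟩⟩

theorem IsContr.add {U : Opens M} {s t s' t' : X.sec U} (h : S.IsContr σ s t)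
    (h' : S.IsContr σ s' t') : S.IsContr σ (s + s') (t + t') := by
  intro c hc w hw hU
  rw [map_add, map_add, map_add, h c hc w hw hU, h' c hc w hw hU]

theorem IsContr.smul {U : Opens M} {s t : X.sec U} (a : ℂ) (h : S.IsContr σ s t) :
    S.IsContr σ (a • s) (a • t) := by
  intro c hc w hw hU
  rw [map_smul, map_smul, map_smul, h c hc w hw hU]

/-- Contraction with a section of the odd tangent bundle. -/
noncomputable def contrField (σ : X.OddSection) : X.PreEnd := fun _ =>
  { toFun := fun s => (S.exists_isContr σ s).choose
    map_add' := fun s t => IsContr.unique (S.exists_isContr σ _).choose_spec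
      (IsContr.add S (S.exists_isContr σ s).choose_spec (S.exists_isContr σ t).choose_spec)
    map_smul' := fun a s => IsContr.unique (S.exists_isContr σ _).choose_spec
      (IsContr.smul S a (S.exists_isContr σ s).choose_spec) }

theorem isContr_contrField (σ : X.OddSection) {U : Opens M} (s : X.sec U) :
    S.IsContr σ s (S.contrField σ U s) := (S.exists_isContr σ s).choose_spec

/-! ### Gradings and locality -/

theorem res_decompose {U V : Opens M} (h : V ≤ U) (q : ℤ) (s : X.sec U) :
    letI := S.graded U
    letI := S.graded V
    X.res h (DirectSum.decompose (S.deg U) s q : X.sec U) =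
      (DirectSum.decompose (S.deg V) (X.res h s) q : X.sec V) := by
  let _ := S.graded U
  let _ := S.graded V
  classical
  conv_rhs => rw [← DirectSum.sum_support_decompose (S.deg U) s]
  rw [map_sum, DirectSum.decompose_sum, DFinsupp.finsetSum_apply, AddSubmonoidClass.coe_finsetSum]
  have h1 : ∀ i, X.res h (DirectSum.decompose (S.deg U) s i : X.sec U) ∈ S.deg V i :=
    fun i => S.res_deg h i _ (SetLike.coe_mem _)
  rw [Finset.sum_eq_single q]
  · rw [DirectSum.decompose_of_mem_same _ (h1 q)]
  · intro i _ hi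
    rw [DirectSum.decompose_of_mem_ne _ (h1 i) hi]
  · intro hq
    rw [DFinsupp.notMem_support_iff.mp hq]
    simp

/-- Restriction commutes with taking homogeneous components, so the components of other degrees
vanish locally, hence globally. -/
theorem mem_deg_of_locally {U : Opens M} {q : ℤ} {s : X.sec U}
    (h : ∀ w ∈ U, ∃ (V : Opens M) (hV : V ≤ U), w ∈ V ∧ X.res hV s ∈ S.deg V q) :
    s ∈ S.deg U q := by
  let _ := S.graded U
  classical
  have h0 : ∀ i, i ≠ q → (DirectSum.decompose (S.deg U) s i : X.sec U) = 0 := by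
    intro i hi
    refine X.eq_zero_of_locally_eq_zero fun w hw => ?_
    obtain ⟨V, hV, hwV, hs⟩ := h w hw
    let _ := S.graded V
    refine ⟨V, hV, hwV, ?_⟩
    rw [S.res_decompose hV, DirectSum.decompose_of_mem_ne _ hs hi.symm]
  rw [← DirectSum.sum_support_decompose (S.deg U) s]
  refine Submodule.sum_mem _ fun i _ => ?_
  rcases eq_or_ne i q with rfl | hi
  · exact SetLike.coe_mem _
  · rw [h0 i hi]; exact zero_mem _

theorem eq_zero_of_mem_deg {U : Opens M} {q : ℤ} (hq : q < 0) {s : X.sec U}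
    (hs : s ∈ S.deg U q) : s = 0 := by
  refine X.eq_zero_of_locally_eq_zero fun w hw => ?_
  obtain ⟨c, hwc, hc⟩ := S.exists_adapted w
  refine ⟨U ⊓ c.source, inf_le_left, ⟨hw, hwc⟩, (c.iso _ inf_le_right).injective ?_⟩
  rw [map_zero]
  exact eq_zero_of_mem_modelDeg hq ((hc _ _ _ _).mp (S.res_deg inf_le_left q s hs))

/-- A family of endomorphisms that shifts degrees shifts parities. -/
theorem mem_parity_of_deg (T : X.PreEnd) (p : ℤ) (U : Opens M)
    (hT : ∀ q, ∀ s ∈ S.deg U q, T U s ∈ S.deg U (q + p)) {b : ZMod 2} {s : X.sec U}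
    (hs : s ∈ X.parity U b) : T U s ∈ X.parity U ((p : ZMod 2) + b) := by
  let _ := S.graded U
  classical
  -- This writes s as the sum of the parity-b projections of its ℤ-components; each projection is
  -- either the whole component or zero.
  have h1 := X.proj_of_mem hs b
  rw [if_pos rfl, ← DirectSum.sum_support_decompose (S.deg U) s, map_sum] at h1
  rw [DirectSum.sum_support_decompose] at h1
  rw [← h1, map_sum]
  refine Submodule.sum_mem _ fun q _ => ?_
  have h2 : (DirectSum.decompose (S.deg U) s q : X.sec U) ∈ S.deg U q := SetLike.coe_mem _
  rw [X.proj_of_mem (S.deg_le_parity U q h2)]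
  split_ifs with hb
  · have h3 := S.deg_le_parity U _ (hT q _ h2)
    rwa [Int.cast_add, hb, add_comm] at h3
  · simp

theorem contrField_deg (σ : X.OddSection) (U : Opens M) (q : ℤ) {s : X.sec U}
    (hs : s ∈ S.deg U q) : S.contrField σ U s ∈ S.deg U (q + -1) := by
  rcases lt_trichotomy q 0 with hq | rfl | hq
  · rw [S.eq_zero_of_mem_deg hq hs, map_zero]
    exact zero_mem _
  · have : S.contrField σ U s = 0 := by
      refine (S.isContr_contrField σ s).unique fun c hc w hw hU => ?_
      have h1 := hc.evAt_mem hw hU le_rfl hs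
      rw [map_zero, ExteriorAlgebra.contr_of_mem_exteriorPower_zero _ _ h1]
    rw [this]
    exact zero_mem _
  · refine S.mem_deg_of_locally fun w hw => ?_
    obtain ⟨c, hwc, hc⟩ := S.exists_adapted w
    refine ⟨U ⊓ c.source, inf_le_left, ⟨hw, hwc⟩, ?_⟩
    refine hc.mem_deg inf_le_right (by omega) fun w' hw' => ?_
    rw [c.evAt_res hw'.2, S.isContr_contrField σ s c hc]
    refine ExteriorAlgebra.contr_mem_exteriorPower _ _ _ ?_
    have h1 := hc.evAt_mem hw'.2 hw'.1 hq.le hs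
    rwa [show (q + -1).toNat + 1 = q.toNat by omega]

/-- The Leibniz rule is inherited from contraction in the exterior algebra, and oddness from the
shift by -1, which is 1 modulo 2. -/
theorem contrField_mem_superDer (σ : X.OddSection) : S.contrField σ ∈ X.superDer 1 := by
  refine ⟨fun U V h s => ?_, fun U b s hs => ?_, fun U b f g hf => ?_⟩
  · exact ((S.isContr_contrField σ s).res h).unique (S.isContr_contrField σ _)
  · have h := S.mem_parity_of_deg (S.contrField σ) (-1) U
      (fun q s hs => S.contrField_deg σ U q hs) hs
    rwa [show ((-1 : ℤ) : ZMod 2) = 1 from rfl] at h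
  · refine (S.isContr_contrField σ _).unique fun c hc w hw hU => ?_
    have v1 : ((1 : ZMod 2)).val = 1 := rfl
    rw [map_mul, ExteriorAlgebra.contr_mul, c.sgn_evAt hw hU hf, map_add, map_smul, map_mul,
      map_mul, S.isContr_contrField σ f c hc, S.isContr_contrField σ g c hc, v1, one_mul,
      smul_mul_assoc]

/-- The vector field given by the contraction with a section of the odd tangent bundle. -/
noncomputable def contrVectorField (σ : X.OddSection) : X.vectorFields :=
  ⟨S.contrField σ, Submodule.mem_iSup_of_mem 1 (S.contrField_mem_superDer σ)⟩

theorem contrVectorField_mem_component (σ : X.OddSection) :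
    S.contrVectorField σ ∈ S.component (-1) := fun U q _ hs => S.contrField_deg σ U q hs

/-! ### Transitivity of the graded superalgebra of vector fields -/

/-- A section of positive degree is zero if all contractions with sections of the odd tangent
bundle are zero. -/
theorem eq_zero_of_contrField_eq_zero
    (hspan : ∀ (w : M) (v : X.OddTangent w), ∃ σ : X.OddSection, σ.val w = v)
    {U : Opens M} {q : ℤ} (hq : 0 < q) {s : X.sec U} (hs : s ∈ S.deg U q)
    (h : ∀ σ, S.contrField σ U s = 0) : s = 0 := by
  refine X.eq_zero_of_locally_eq_zero fun w hw => ?_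
  obtain ⟨c, hwc, hc⟩ := S.exists_adapted w
  refine ⟨U ⊓ c.source, inf_le_left, ⟨hw, hwc⟩, c.eq_of_evAt inf_le_right fun w' hw' => ?_⟩
  rw [c.evAt_res hw'.2, map_zero]
  refine ExteriorAlgebra.eq_zero_of_contr_eq_zero (Pi.basisFun ℂ (Fin m)) (by omega)
    (hc.evAt_mem hw'.2 hw'.1 hq.le hs) fun φ => ?_
  obtain ⟨σ, hσ⟩ := hspan w' (c.tangent w' hw'.2 φ)
  have h1 := S.isContr_contrField σ s c hc w' hw'.2 hw'.1
  rwa [h, map_zero, hσ, c.coords_tangent, eq_comm] at h1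

/-- A superderivation is determined by its values on sections of degrees zero and one. -/
theorem superDer_eq_zero {a : ZMod 2} {δ : X.PreEnd} (hδ : δ ∈ X.superDer a)
    (h0 : ∀ U, ∀ s ∈ S.deg U 0, δ U s = 0) (h1 : ∀ U, ∀ s ∈ S.deg U 1, δ U s = 0) : δ = 0 := by
  funext U
  ext s
  refine X.eq_zero_of_locally_eq_zero fun w hw => ?_
  obtain ⟨c, hwc, hc⟩ := S.exists_adapted w
  have hW : U ⊓ c.source ≤ c.source := inf_le_right
  refine ⟨U ⊓ c.source, inf_le_left, ⟨hw, hwc⟩, ?_⟩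
  rw [hδ.1 U _ inf_le_left]
  suffices H : ∀ z, δ (U ⊓ c.source) ((c.iso _ hW).symm z) = 0 by
    have := H (c.iso _ hW (X.res inf_le_left s))
    rwa [AlgEquiv.symm_apply_apply] at this
  intro z
  induction z using TensorProduct.induction_on with
  | zero => simp
  | tmul f a =>
    -- The induction peels off one odd coordinate at a time, keeping f in the remaining factor; the
    -- base case is a section of degree zero.
    induction a using CliffordAlgebra.left_induction with
    | algebraMap r =>
      refine h0 _ _ ?_
      rw [hc _ hW, AlgEquiv.apply_symm_apply, mem_modelDeg_iff le_rfl]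
      intro x
      rw [modelEv_tmul]
      refine Submodule.smul_mem _ _ ?_
      rw [Int.toNat_zero, ExteriorAlgebra.exteriorPower_zero_eq]
      exact Submodule.mem_one.mpr ⟨r, rfl⟩
    | add a b ha hb => rw [TensorProduct.tmul_add, map_add, map_add, ha, hb, add_zero]
    | ι_mul b v hb =>
      have h2 : f ⊗ₜ[ℂ] (CliffordAlgebra.ι (0 : QuadraticForm ℂ (Fin m → ℂ)) v * b) =
          (1 ⊗ₜ ExteriorAlgebra.ι ℂ v) * (f ⊗ₜ b) := by
        rw [Algebra.TensorProduct.tmul_mul_tmul, one_mul]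
      have h3 : (c.iso _ hW).symm (1 ⊗ₜ ExteriorAlgebra.ι ℂ v) ∈ S.deg (U ⊓ c.source) 1 := by
        rw [hc _ hW, AlgEquiv.apply_symm_apply, mem_modelDeg_iff zero_le_one]
        intro x
        rw [modelEv_tmul]
        exact Submodule.smul_mem _ _ (ExteriorAlgebra.ι_mem_exteriorPower_one v)
      rw [h2, map_mul]
      refine (hδ.2.2 _ 1 _ _ (c.xi_mem_parity hW v)).trans ?_
      rw [show δ _ (c.xi hW v) = 0 from h1 _ _ h3, hb]
      simp
  | add z z' hz hz' => rw [map_add, map_add, hz, hz', add_zero]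

theorem twist_deg (T : X.PreEnd) (U : Opens M) (q p : ℤ) (s : X.sec U) (hs : s ∈ S.deg U q)
    (hT : T U s ∈ S.deg U (q + p)) : X.twist T U s ∈ S.deg U (q + p) :=
  sub_mem (S.part_deg T U q p s hs hT 0) (S.part_deg T U q p s hs hT 1)

/-- If the twist kills s, the even and odd parts of x agree on s. Their images have opposite
parities, so both vanish. -/
theorem part_eq_zero_of_twist_eq_zero {x : X.PreEnd} (hx : x ∈ X.vectorFields) {U : Opens M} {q : ℤ}
    {s : X.sec U} (hs : s ∈ S.deg U q) (h : X.twist x U s = 0) (a : ZMod 2) :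
    X.part a x U s = 0 := by
  have hp : ∀ a, X.part a x U s ∈ X.parity U (a + (q : ZMod 2)) := fun a =>
    (X.part_mem_superDer hx a).2.1 U _ s (S.deg_le_parity U q hs)
  have he : X.part 0 x U s = X.part 1 x U s := sub_eq_zero.mp h
  have h0 : X.part 0 x U s = 0 := by
    have h2 := X.proj_of_mem (hp 0) (0 + q)
    have h3 := X.proj_of_mem (hp 1) (0 + q)
    rw [if_pos rfl] at h2
    rw [if_neg (by simp), ← he, h2] at h3
    exact h3
  have two : ∀ z : ZMod 2, z = 0 ∨ z = 1 := by decide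
  rcases two a with rfl | rfl
  · exact h0
  · rw [← he, h0]

/-- Only brackets with contraction fields, all of degree -1, are used. Since p > 0, x maps sections
of degrees 0 and 1 into positive degree, where contractions detect zero. -/
theorem transitiveInDegree_of_pos
    (hspan : ∀ (w : M) (v : X.OddTangent w), ∃ σ : X.OddSection, σ.val w = v) {p : ℤ}
    (hp : 0 < p) : TransitiveInDegree X.bracket S.component p := by
  intro x hx hxy
  have hbr : ∀ (σ : X.OddSection) (U : Opens M) (s : X.sec U),
      x.1 U (S.contrField σ U s) = S.contrField σ U (X.twist x.1 U s) := by
    intro σ U s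
    have h1 := hxy (S.contrVectorField σ) (Submodule.mem_iSup_of_mem (-1)
      (Submodule.mem_iSup_of_mem (by norm_num) (S.contrVectorField_mem_component σ)))
    have h2 : X.superBracket x.1 (S.contrField σ) U s = 0 :=
      congrArg (fun z : X.vectorFields => z.1 U s) h1
    rw [X.superBracket_odd x.1 (S.contrField_mem_superDer σ)] at h2
    exact sub_eq_zero.mp h2
  -- If x kills every contraction of s, commutation makes all contractions of the twisted image of s
  -- vanish; this image has degree q + p > 0 and is therefore zero.
  have hkill : ∀ (q : ℤ), 0 ≤ q → ∀ U, ∀ s ∈ S.deg U q,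
      (∀ σ, x.1 U (S.contrField σ U s) = 0) → ∀ a, X.part a x.1 U s = 0 := by
    intro q hq U s hs h a
    refine S.part_eq_zero_of_twist_eq_zero x.2 hs ?_ a
    refine S.eq_zero_of_contrField_eq_zero hspan (q := q + p) (by omega)
      (S.twist_deg x.1 U q p s hs (hx U q s hs)) fun σ => ?_
    rw [← hbr, h]
  have h0 : ∀ a U, ∀ s ∈ S.deg U 0, X.part a x.1 U s = 0 := by
    intro a U s hs
    refine hkill 0 le_rfl U s hs (fun σ => ?_) a
    rw [S.eq_zero_of_mem_deg (by norm_num) (S.contrField_deg σ U 0 hs), map_zero]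
  have h1 : ∀ a U, ∀ s ∈ S.deg U 1, X.part a x.1 U s = 0 := by
    intro a U s hs
    refine hkill 1 zero_le_one U s hs (fun σ => ?_) a
    have h2 := S.contrField_deg σ U 1 hs
    rw [add_neg_cancel] at h2
    conv_lhs => rw [← X.part_add_part x.1]
    change X.part 0 x.1 U _ + X.part 1 x.1 U _ = 0
    rw [h0 0 U _ h2, h0 1 U _ h2, add_zero]
  ext1
  rw [← X.part_add_part x.1,
    S.superDer_eq_zero (X.part_mem_superDer x.2 0) (h0 0) (h1 0),
    S.superDer_eq_zero (X.part_mem_superDer x.2 1) (h0 1) (h1 1)]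
  exact add_zero _

theorem transitiveInDegree_zero (hinj : Function.Injective S.adjoint) :
    TransitiveInDegree X.bracket S.component 0 := by
  intro x hx hxy
  have h0 : S.adjoint ⟨x, hx⟩ = 0 := by
    ext1 y
    ext1
    exact hxy y.1 (Submodule.mem_iSup_of_mem (-1) (Submodule.mem_iSup_of_mem (by norm_num) y.2))
  exact congrArg Subtype.val (hinj (h0.trans (map_zero S.adjoint).symm))

end SplitStructure

theorem mainTheorem7 {M : Type u} [TopologicalSpace M] (X : SuperSpace M) (n m : ℕ) :
    (IsSupermanifold X n m →
      (∀ (w : M) (v : X.OddTangent w), ∃ σ ∈ X.inducedSections, σ.val w = v) →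
      Function.Injective X.grAdjoint →
      IsTransitiveFiltered X.bracket X.filtration) ∧
    (∀ S : SplitStructure X n m,
      (∀ (w : M) (v : X.OddTangent w), ∃ σ : X.OddSection, σ.val w = v) →
      (∀ p : ℤ, 0 < p → TransitiveInDegree X.bracket S.component p) ∧
      (Function.Injective S.adjoint → IsTransitiveGraded X.bracket S.component)) := by
  refine ⟨X.isTransitiveFiltered, fun S hspan =>
    ⟨fun p hp => S.transitiveInDegree_of_pos hspan hp, fun hinj p hp => ?_⟩⟩
  rcases hp.eq_or_lt with rfl | hp
  · exact S.transitiveInDegree_zero hinj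
  · exact S.transitiveInDegree_of_pos hspan hp
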